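/- Write $e(z)=e^{2\pi i z}$ and let $\eta$ be the Dedekind eta function. For an even lattice $L$ (with quadratic form $q(x)=\langle x,x\rangle/2$) of signature $(2,n)$, $n$ even, let $L'$ be the dual lattice, $D=L'/L$ the discriminant form with $Q=q \bmod 1$ and bilinear form $(\beta,\gamma)=Q(\beta+\gamma)-Q(\beta)-Q(\gamma)$, and let $\rho_L$ be the Weil representation of $\mathrm{SL}_2(\mathbb Z)$ on $\mathbb C[D]$, i.e. the unique representation with $\rho_L(T)\mathfrak e_\gamma=e(Q(\gamma))\mathfrak e_\gamma$ and $\rho_L(S)\mathfrak e_\gamma=\frac{e(-(2-n)/8)}{\sqrt{|D|}}\sum_{\beta\in D}e(-(\beta,\gamma))\mathfrak e_\beta$. A weakly holomorphic modular form of weight $k$ for $\rho_L$ is a holomorphic $F=\sum_\gamma f_\gamma\mathfrak e_\gamma:\mathbb H\to\mathbb C[D]$ with $F(M\tau)=(c\tau+d)^k\rho_L(M)F(\tau)$ for all $M=\left(\begin{smallmatrix}a&b\\c&d\end{smallmatrix}\right)\in\mathrm{SL}_2(\mathbb Z)$ and expansions $f_\gamma(\tau)=\sum_{m\in\mathbb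 Z+Q(\gamma),\,m\gg-\infty}c(\gamma,m)e(m\tau)$; its principal part is $\sum_\gamma\sum_{m<0}c(\gamma,m)e(m\tau)\mathfrak e_\gamma$, and the weight of the automorphic product attached to $F$ by the singular theta correspondence is, by definition here, $c(0,0)/2$. The singular weight is $n/2-1$. For a function $f$ on $\mathbb H$ and $\gamma \in D$ the $\Gamma_1(N)$-lift of $f$ of weight $k$ on $\mathfrak e_\gamma$ is $$F_{\Gamma_1(N),f,\gamma}(\tau)=\sum_{M\in\Gamma_1(N)\backslash\mathrm{SL}_2(\mathbb Z)}f|_kM(\tau)\,\rho_L(M^{-1})\mathfrak e_\gamma .$$ If $g(\tau)=\sum_{j\ge0}a(j)e(j\tau/N)$, then $g_x$, for $x\in\mathbb Q/\mathbb Z$, denotes the sum of the terms with $j/N\equiv x \bmod 1$. Theorem. In the following two cases $\rho_L$ exists, elements $\gamma$ as described exist, and for each of them the summands of the lift do not depend on the chosen coset representatives. (1) Let $L$ be an even lattice of genus $\mathrm{II}_{2,4}(3^{+5})$ (signature $(2,4)$, discriminant form $3^{+5}$), $\gamma\in D$ with $Q(\gamma)\equiv-1/3\bmod 1$, and $f(\tau)=\eta(\tau)/\eta(3\tau)^3$.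 Then $F=F_{\Gamma_1(3),f,\gamma}$ is a weakly holomorphic modular form of weight $-1$ for $\rho_L$, and it is the unique such form with principal part $e(-\tau/3)\mathfrak e_\gamma+e(-\tau/3)\mathfrak e_{-\gamma}$. With $g(\tau)=f|_{-1}S(\tau)=3\sqrt3\,i\,\eta(\tau)/\eta(\tau/3)^3$, which has an expansion in non-negative powers of $e(\tau/3)$, $$F=f\mathfrak e_\gamma+f\mathfrak e_{-\gamma}-\frac{3i}{\sqrt{243}}\sum_{\beta\in D}\bigl[e((\beta,\gamma))+e(-(\beta,\gamma))\bigr]g_{Q(\beta)}\mathfrak e_\beta .$$ Its constant coefficient is $c(0,0)=2$, so $c(0,0)/2=1=4/2-1$ is the singular weight. (2) Let $L$ be an even lattice of genus $\mathrm{II}_{2,6}(2_{\mathrm{II}}^{-6})$ (signature $(2,6)$, discriminant form $2_{\mathrm{II}}^{-6}$), $\gamma\in D$ with $Q(\gamma)\equiv1/2\bmod 1$, and $f(\tau)=\eta(\tau)^4/\eta(2\tau)^8$. Then $F=F_{\Gamma_1(2),f,\gamma}$ is a weakly holomorphic modular form of weight $-2$ for $\rho_L$, and it is the unique such form with principal part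 $e(-\tau/2)\mathfrak e_\gamma$. With $g(\tau)=f|_{-2}S(\tau)=-16\,\eta(\tau)^4/\eta(\tau/2)^8$, which has an expansion in non-negative powers of $e(\tau/2)$, $$F=f\mathfrak e_\gamma-\frac14\sum_{\beta\in D}e((\beta,\gamma))\,g_{Q(\beta)}\mathfrak e_\beta .$$ Its constant coefficient is $c(0,0)=4$, so $c(0,0)/2=2=6/2-1$ is the singular weight. -/

import Mathlib

open scoped MatrixGroups ModularForm Manifold UpperHalfPlane

noncomputable section

namespace BorcherdsLift

/-- The group `ℚ/ℤ`. -/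
abbrev QmodZ : Type := AddCircle (1 : ℚ)

/-- `e(z) = exp(2πiz)` for complex `z`. -/
def e (z : ℂ) : ℂ := Complex.exp (2 * Real.pi * Complex.I * z)

theorem e_add_int (z : ℂ) (n : ℤ) : e (z + n) = e z := by
  unfold e
  rw [mul_add, Complex.exp_add,
    show 2 * (Real.pi : ℂ) * Complex.I * n = n * (2 * Real.pi * Complex.I) by ring,
    Complex.exp_int_mul_two_pi_mul_I, mul_one]

/-- `e(x) = exp(2πix)` for `x ∈ ℚ/ℤ`. -/
def eQ (x : QmodZ) : ℂ :=
  Quotient.liftOn' x (fun r : ℚ => e (r : ℂ)) (by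
    intro a b hab
    rw [QuotientAddGroup.leftRel_apply] at hab
    obtain ⟨n, hn⟩ := AddSubgroup.mem_zmultiples_iff.mp hab
    have hb : b = a + (n : ℚ) := by
      have h : (n : ℚ) = -a + b := by simpa using hn
      rw [h]; ring
    change e (a : ℂ) = e (b : ℂ)
    rw [hb]
    push_cast
    exact (e_add_int _ n).symm)

/-- A (nondegenerate) even lattice of full rank in the rational vector space `V`: a finitely
generated subgroup `L` spanning `V`, together with a nondegenerate quadratic form `q` on `V` that
takes integral values on `L`.  The associated bilinear form is the polar form
`⟨x, y⟩ = q (x + y) - q x - q y`, so that `q x = ⟨x, x⟩ / 2`. -/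
structure EvenLattice (V : Type*) [AddCommGroup V] [Module ℚ V] where
  q : QuadraticForm ℚ V
  nondegenerate : (QuadraticMap.polarBilin q).Nondegenerate
  carrier : Submodule ℤ V
  fg : carrier.FG
  span_eq_top : Submodule.span ℚ (carrier : Set V) = ⊤
  even : ∀ x ∈ carrier, ∃ n : ℤ, q x = n

namespace EvenLattice

variable {V : Type*} [AddCommGroup V] [Module ℚ V] (L : EvenLattice V)

/-- The signature of `L` is `(bp, bm)`. -/
def HasSignature (bp bm : ℕ) : Prop := _root_.sigPos L.q = bp ∧ _root_.sigNeg L.q = bm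

/-- The difference `r = b⁺ - b⁻`. -/
def sigDiff : ℤ := (_root_.sigPos L.q : ℤ) - (_root_.sigNeg L.q : ℤ)

/-- The dual lattice `L'`. -/
def dual : Submodule ℤ V := LinearMap.BilinForm.dualSubmodule (QuadraticMap.polarBilin L.q) L.carrier

/-- The discriminant group `D = L'/L`. -/
abbrev Disc : Type _ := L.dual ⧸ L.carrier.submoduleOf L.dual

/-- The discriminant quadratic form `Q : D → ℚ/ℤ`, the reduction of `q` modulo `1`. -/
def Q (γ : L.Disc) : QmodZ :=
  Quotient.liftOn' γ (fun x : L.dual => ((L.q (x : V) : ℚ) : QmodZ)) (by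
    intro x y hxy
    have h : x - y ∈ L.carrier.submoduleOf L.dual := (Submodule.quotientRel_def _).mp hxy
    have h' : (x : V) - (y : V) ∈ L.carrier := h
    obtain ⟨n, hn⟩ := L.even _ h'
    obtain ⟨m, hm⟩ := Submodule.mem_one.mp (y.2 _ h')
    have hm' : (m : ℚ) = QuadraticMap.polar L.q (y : V) ((x : V) - (y : V)) := by
      simpa using hm
    rw [QuadraticMap.polar, add_sub_cancel, hn] at hm'
    have hx : L.q (x : V) = L.q (y : V) + ((n + m : ℤ) : ℚ) := by
      push_cast
      linarith
    change ((L.q (x : V) : ℚ) : QmodZ) = ((L.q (y : V) : ℚ) : QmodZ)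
    rw [hx, AddCircle.coe_add]
    have hz : (((n + m : ℤ) : ℚ) : QmodZ) = 0 :=
      (AddCircle.coe_eq_zero_iff 1).mpr ⟨n + m, by simp⟩
    rw [hz, add_zero])

/-- The bilinear form `(β, γ) = Q(β + γ) - Q(β) - Q(γ)` on `D`. -/
def pairing (β γ : L.Disc) : QmodZ := L.Q (β + γ) - L.Q β - L.Q γ

/-- The discriminant form of `L` is `p^{ε n}`, for an odd prime `p`: an orthogonal sum of `n` cyclic
groups of order `p` with generators of norm `aᵢ/p mod 1`, where `∏ᵢ (2aᵢ / p) = ε`. -/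
def HasOddDiscForm (p : ℕ) [Fact p.Prime] (ε : ℤ) (n : ℕ) : Prop :=
  ∃ (a : Fin n → ℤ) (φ : (Fin n → ZMod p) ≃+ L.Disc),
    (∏ i, legendreSym p (2 * a i)) = ε ∧
    ∀ x : Fin n → ℤ,
      L.Q (φ fun i => (x i : ZMod p)) = (((∑ i, a i * x i ^ 2 : ℤ) / (p : ℚ) : ℚ) : QmodZ)

/-- The discriminant form of `L` is `2_{II}^{ε 2n}`: an orthogonal sum of `n` copies of `(ℤ/2)²`, each
with quadratic form `xy/2` (sign `1`) or `(x² + xy + y²)/2` (sign `-1`), the product of the signs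
being `ε`. -/
def HasEvenTwoDiscForm (ε : ℤ) (n : ℕ) : Prop :=
  ∃ (s : Fin n → ℤ) (φ : (Fin n → ZMod 2 × ZMod 2) ≃+ L.Disc),
    (∀ i, s i = 1 ∨ s i = -1) ∧ (∏ i, s i) = ε ∧
    ∀ x y : Fin n → ℤ,
      L.Q (φ fun i => ((x i : ZMod 2), (y i : ZMod 2))) =
        (((∑ i, (if s i = 1 then x i * y i else x i ^ 2 + x i * y i + y i ^ 2) : ℤ) / (2 : ℚ) : ℚ)
          : QmodZ)

/-- The genus `II_{2,4}(3^{+5})`. -/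
def IsGenus_II_2_4_3_5 : Prop := L.HasSignature 2 4 ∧ L.HasOddDiscForm 3 1 5

/-- The genus `II_{2,6}(2_{II}^{-6})`. -/
def IsGenus_II_2_6_2_6 : Prop := L.HasSignature 2 6 ∧ L.HasEvenTwoDiscForm (-1) 3

open scoped Classical in
/-- The basis vector `e_γ` of `ℂ[D]`; as `D` is finite, `ℂ[D]` is the space of functions `D → ℂ`. -/
def basisVec (γ : L.Disc) : L.Disc → ℂ := fun δ => if δ = γ then 1 else 0

/-- `ρ` is the Weil representation of `SL₂(ℤ)` on `ℂ[D]`, given on the generators `T` and `S` by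
`ρ(T) e_γ = e(Q(γ)) e_γ` and
`ρ(S) e_γ = e(-r/8) / √|D| * ∑ β, e(-(β, γ)) e_β`. -/
def IsWeilRepresentation (ρ : Representation ℂ SL(2, ℤ) (L.Disc → ℂ)) : Prop :=
  (∀ γ : L.Disc, ρ ModularGroup.T (L.basisVec γ) = eQ (L.Q γ) • L.basisVec γ) ∧
  (∀ γ β : L.Disc, ρ ModularGroup.S (L.basisVec γ) β =
    e (-(L.sigDiff : ℂ) / 8) / (Real.sqrt (Nat.card L.Disc) : ℂ) * eQ (-L.pairing β γ))

/-- `c` is the family of Fourier coefficients of `F = ∑ F_γ e_γ`: for every `γ`,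
`F_γ(τ) = ∑ c(γ, m) e(mτ)` over `m ∈ ℤ + Q(γ)`, `m ≫ -∞`. -/
def IsFourierExpansion (F : ℍ → L.Disc → ℂ) (c : L.Disc → ℚ → ℂ) : Prop :=
  (∀ γ m, c γ m ≠ 0 → (m : QmodZ) = L.Q γ) ∧
  (∃ m₀ : ℚ, ∀ γ m, m < m₀ → c γ m = 0) ∧
  (∀ γ (τ : ℍ), HasSum (fun m : ℚ => c γ m * e ((m : ℂ) * τ)) (F τ γ))

/-- `F` is a weakly holomorphic vector valued modular form of weight `k` for `ρ`. -/
structure IsWeaklyHolomorphicForm (ρ : Representation ℂ SL(2, ℤ) (L.Disc → ℂ)) (k : ℤ)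
    (F : ℍ → L.Disc → ℂ) : Prop where
  holomorphic : ∀ γ, MDifferentiable 𝓘(ℂ) 𝓘(ℂ) (fun τ : ℍ => F τ γ)
  transform : ∀ (M : SL(2, ℤ)) (τ : ℍ),
    F (M • τ) = ((M 1 0 : ℂ) * (τ : ℂ) + (M 1 1 : ℂ)) ^ k • ρ M (F τ)
  expansion : ∃ c, L.IsFourierExpansion F c

/-- `F` has principal part `∑_γ ∑_{m<0} P(γ, m) e(mτ) e_γ`. -/
def HasPrincipalPart (F : ℍ → L.Disc → ℂ) (P : L.Disc → ℚ → ℂ) : Prop :=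
  ∃ c, L.IsFourierExpansion F c ∧ ∀ γ m, m < 0 → c γ m = P γ m

/-- `F` has constant coefficient `c(0, 0) = a`. -/
def HasConstantCoeff (F : ℍ → L.Disc → ℂ) (a : ℂ) : Prop :=
  ∃ c, L.IsFourierExpansion F c ∧ c 0 0 = a

/-- The automorphic product attached to `F` by the singular theta correspondence has weight
`c(0, 0) / 2 = w`. -/
def HasAutomorphicProductWeight (F : ℍ → L.Disc → ℂ) (w : ℂ) : Prop :=
  ∃ c, L.IsFourierExpansion F c ∧ c 0 0 / 2 = w

/-- The summand `f|_k M (τ) ρ(M⁻¹) e_γ` of the lift. -/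
def liftTerm (ρ : Representation ℂ SL(2, ℤ) (L.Disc → ℂ)) (k : ℤ) (f : ℍ → ℂ) (γ : L.Disc)
    (M : SL(2, ℤ)) (τ : ℍ) : L.Disc → ℂ :=
  (f ∣[k] M) τ • ρ M⁻¹ (L.basisVec γ)

/-- The lift `F_{Γ₁(N), f, γ}(τ) = ∑_{M ∈ Γ₁(N)\SL₂(ℤ)} f|_k M (τ) ρ(M⁻¹) e_γ`, a finite sum over the
cosets `Γ₁(N) M`. -/
def lift (ρ : Representation ℂ SL(2, ℤ) (L.Disc → ℂ)) (N : ℕ) (k : ℤ) (f : ℍ → ℂ) (γ : L.Disc)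
    (τ : ℍ) : L.Disc → ℂ :=
  ∑ᶠ x : Quotient (QuotientGroup.rightRel (CongruenceSubgroup.Gamma1 N)),
    L.liftTerm ρ k f γ (Quotient.out x) τ

/-- The summands of the lift do not depend on the choice of representatives `M` of the cosets. -/
def LiftIsWellDefined (ρ : Representation ℂ SL(2, ℤ) (L.Disc → ℂ)) (N : ℕ) (k : ℤ) (f : ℍ → ℂ)
    (γ : L.Disc) : Prop :=
  ∀ A ∈ CongruenceSubgroup.Gamma1 N, ∀ (M : SL(2, ℤ)) (τ : ℍ),
    L.liftTerm ρ k f γ (A * M) τ = L.liftTerm ρ k f γ M τ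

end EvenLattice

/-- The function `g` on `ℍ` has the expansion `g(τ) = ∑_{n ≥ 0} a(n) e(nτ/N)`. -/
def HasExpansion (N : ℕ) (a : ℕ → ℂ) (g : ℍ → ℂ) : Prop :=
  ∀ τ : ℍ, HasSum (fun n : ℕ => a n * e ((n : ℂ) * τ / N)) (g τ)

open scoped Classical in
/-- For `g(τ) = ∑ a(n) e(nτ/N)`, the part `g_x` of `g` consisting of the terms whose exponent `n/N`
is congruent to `x` modulo `1`. -/
def expansionPart (N : ℕ) (a : ℕ → ℂ) (x : QmodZ) (τ : ℍ) : ℂ :=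
  ∑' n : ℕ, if (((n : ℚ) / N : ℚ) : QmodZ) = x then a n * e ((n : ℂ) * τ / N) else 0

/-- The eta product `η(τ) / η(3τ)³`. -/
def etaProduct3 (τ : ℍ) : ℂ := ModularForm.eta τ / ModularForm.eta (3 * τ) ^ 3

/-- The eta product `η(τ)⁴ / η(2τ)⁸`. -/
def etaProduct2 (τ : ℍ) : ℂ := ModularForm.eta τ ^ 4 / ModularForm.eta (2 * τ) ^ 8

/-- The singular weight `n/2 - 1` for signature `(2, n)`. -/
def singularWeight (n : ℕ) : ℂ := n / 2 - 1

end BorcherdsLift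

end

namespace BorcherdsLift

/-! ### The characters `e` and `eQ` -/

/-! Both cases are one argument for `N = 3`, `k = -1` and `N = 2`, `k = -2`, where `r = 2k` is the
signature difference. Three facts about `N` are used: every nonzero residue modulo `N` is `±1`,
`Γ₁(N)` is generated by `T`, `S T^N S⁻¹` and, for `N = 2`, also `-1`, and its cosets are represented
by `±1` and `±S T^j` (a single sign for `N = 2`).

Weil representation: the operators for `S` and `T` satisfy `s⁴ = 1`, `(st)³ = s²`, `t^N = 1`, and
`s² = 1` if `N = 2`. This needs only orthogonality of characters and Milgram's formula `∑ e(Q(γ)) =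
√|D| e(r/8)`, which is computed from the orthogonal decomposition of `D`. By the Bruhat
decomposition these relations present enough of `SL₂(ℤ/N)` to give a homomorphism trivial on `Γ(N)`
(`exists_hom_of_relations`).

Lift: the eta quotient `f` has order `-1/N` at `∞` and order `0` at the cusp `0` (`IsLiftable`). Its
multiplier under `T` cancels the eigenvalue of `e_γ`, and it is fixed by `S T^N S⁻¹`, so the
summands depend only on the coset (`liftIsWellDefined`). Right translation of cosets gives the
transformation law. The cosets of `±1` contribute `f` on `±γ`; summing over `S T^j` with `j` modulo
`N` is a discrete Fourier projection and leaves the part of `g = f|S` with exponents in `Q(β) + ℤ`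
(`lift_apply`). Hence the only pole comes from `f`, and the constant term is `(-1)^k e(-r/8) N (N-1)
a(0) / √|D|`.

Uniqueness: the components of a difference of two forms with equal principal parts are holomorphic
modular forms of negative weight for `Γ(N)`, hence zero
(`IsWeaklyHolomorphicForm.eq_of_principalPart`). -/

theorem e_add (z w : ℂ) : e (z + w) = e z * e w := by
  simp only [e, mul_add, Complex.exp_add]

theorem e_ne_zero (z : ℂ) : e z ≠ 0 := Complex.exp_ne_zero _

@[simp] theorem e_zero : e 0 = 1 := by simp [e]

theorem e_nat_mul (n : ℕ) (z : ℂ) : e (n * z) = e z ^ n := by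
  rw [e, e, ← Complex.exp_nat_mul]
  ring_nf

theorem norm_e (z : ℂ) : ‖e z‖ = Real.exp (-(2 * Real.pi * z.im)) := by
  rw [e, Complex.norm_exp]
  simp [mul_assoc]

@[simp] theorem eQ_coe (r : ℚ) : eQ (r : QmodZ) = e (r : ℂ) := rfl

theorem eQ_add (x y : QmodZ) : eQ (x + y) = eQ x * eQ y := by
  induction x using QuotientAddGroup.induction_on with | H r => ?_
  induction y using QuotientAddGroup.induction_on with | H s => ?_
  change eQ (((r + s : ℚ)) : QmodZ) = e r * e s
  rw [eQ_coe, ← e_add]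
  push_cast
  rfl

@[simp] theorem eQ_zero : eQ 0 = 1 := by
  have h : eQ ((0 : ℚ) : QmodZ) = 1 := by rw [eQ_coe]; simp
  exact h

theorem eQ_neg (x : QmodZ) : eQ (-x) = (eQ x)⁻¹ := by
  refine eq_inv_of_mul_eq_one_left ?_
  rw [← eQ_add, neg_add_cancel, eQ_zero]

theorem eQ_neg_mul_self (x : QmodZ) : eQ (-x) * eQ x = 1 := by
  rw [← eQ_add, neg_add_cancel, eQ_zero]

theorem eQ_nsmul (n : ℕ) (x : QmodZ) : eQ (n • x) = eQ x ^ n := by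
  induction n with
  | zero => simp
  | succ n ih => rw [succ_nsmul, eQ_add, ih, pow_succ]

theorem coe_int_QmodZ (n : ℤ) : ((n : ℚ) : QmodZ) = 0 :=
  (AddCircle.coe_eq_zero_iff 1).mpr ⟨n, by simp⟩

theorem coe_QmodZ_eq_zero_iff (r : ℚ) : (r : QmodZ) = 0 ↔ ∃ n : ℤ, (n : ℚ) = r := by
  rw [AddCircle.coe_eq_zero_iff]
  simp

theorem eQ_eq_one_iff (x : QmodZ) : eQ x = 1 ↔ x = 0 := by
  refine ⟨fun h => ?_, by rintro rfl; simp⟩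
  induction x using QuotientAddGroup.induction_on with | H r => ?_
  change e (r : ℂ) = 1 at h
  rw [e, Complex.exp_eq_one_iff] at h
  obtain ⟨n, hn⟩ := h
  refine (coe_QmodZ_eq_zero_iff r).mpr ⟨n, ?_⟩
  have h2 : (2 * Real.pi * Complex.I : ℂ) ≠ 0 := Complex.two_pi_I_ne_zero
  have h3 : (2 * Real.pi * Complex.I : ℂ) * (n - r) = 0 := by linear_combination -hn
  have h4 : (n : ℂ) = r := sub_eq_zero.mp ((mul_eq_zero.mp h3).resolve_left h2)
  exact_mod_cast h4

/-- Orthogonality of the characters of a cyclic group. -/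
theorem sum_range_eQ_nsmul {N : ℕ} {x : QmodZ} (hx : N • x = 0) [Decidable (x = 0)] :
    ∑ j ∈ Finset.range N, eQ (j • x) = if x = 0 then (N : ℂ) else 0 := by
  split_ifs with h
  · simp [h]
  · have h1 : eQ x - 1 ≠ 0 := sub_ne_zero.mpr fun h' => h ((eQ_eq_one_iff x).mp h')
    have h2 := geom_sum_mul (eQ x) N
    rw [← eQ_nsmul, hx, eQ_zero, sub_self] at h2
    simpa [eQ_nsmul] using (mul_eq_zero.mp h2).resolve_right h1

namespace EvenLattice

variable {V : Type*} [AddCommGroup V] [Module ℚ V] (L : EvenLattice V)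

/-! ### The discriminant form -/

theorem Q_mk (x : L.dual) : L.Q (Submodule.Quotient.mk x) = ((L.q (x : V) : ℚ) : QmodZ) := rfl

theorem pairing_mk (x y : L.dual) :
    L.pairing (Submodule.Quotient.mk x) (Submodule.Quotient.mk y) =
      ((QuadraticMap.polar L.q (x : V) (y : V) : ℚ) : QmodZ) := by
  rw [pairing, ← Submodule.Quotient.mk_add, Q_mk, Q_mk, Q_mk, QuadraticMap.polar]
  rfl

@[simp] theorem Q_zero : L.Q 0 = 0 := by
  rw [← Submodule.Quotient.mk_zero, Q_mk]
  simp

@[simp] theorem Q_neg (γ : L.Disc) : L.Q (-γ) = L.Q γ := by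
  obtain ⟨x, rfl⟩ := Submodule.Quotient.mk_surjective _ γ
  rw [← Submodule.Quotient.mk_neg, Q_mk, Q_mk]
  simp

theorem Q_add (β γ : L.Disc) : L.Q (β + γ) = L.Q β + L.Q γ + L.pairing β γ := by
  rw [pairing]; abel

theorem pairing_comm (β γ : L.Disc) : L.pairing β γ = L.pairing γ β := by
  rw [pairing, pairing, add_comm]; abel

theorem pairing_add_left (α β γ : L.Disc) :
    L.pairing (α + β) γ = L.pairing α γ + L.pairing β γ := by
  obtain ⟨x, rfl⟩ := Submodule.Quotient.mk_surjective _ α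
  obtain ⟨y, rfl⟩ := Submodule.Quotient.mk_surjective _ β
  obtain ⟨z, rfl⟩ := Submodule.Quotient.mk_surjective _ γ
  rw [← Submodule.Quotient.mk_add, pairing_mk, pairing_mk, pairing_mk, Submodule.coe_add,
    QuadraticMap.polar_add_left]
  rfl

theorem pairing_add_right (α β γ : L.Disc) :
    L.pairing α (β + γ) = L.pairing α β + L.pairing α γ := by
  simp only [L.pairing_comm α, pairing_add_left]

@[simp] theorem pairing_zero_left (γ : L.Disc) : L.pairing 0 γ = 0 := by
  simp [pairing]

@[simp] theorem pairing_zero_right (γ : L.Disc) : L.pairing γ 0 = 0 := by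
  simp [pairing]

@[simp] theorem pairing_neg_left (β γ : L.Disc) : L.pairing (-β) γ = -L.pairing β γ := by
  rw [eq_neg_iff_add_eq_zero, ← pairing_add_left, neg_add_cancel, pairing_zero_left]

@[simp] theorem pairing_neg_right (β γ : L.Disc) : L.pairing β (-γ) = -L.pairing β γ := by
  rw [pairing_comm, pairing_neg_left, pairing_comm]

/-- The properties of a discriminant form of level dividing `N` on which the construction of the
Weil representation rests. -/
structure IsNiceOfLevel (N : ℕ) : Prop where
  finite : Finite L.Disc
  nsmul_Q : ∀ γ, N • L.Q γ = 0
  nondegenerate : ∀ γ, (∀ β, L.pairing β γ = 0) → γ = 0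
  gauss_sum : ∑ᶠ γ, eQ (L.Q γ) = (Real.sqrt (Nat.card L.Disc) : ℂ) * e ((L.sigDiff : ℂ) / 8)

variable {L}

/-- For `γ ≠ 0` some `α` pairs nontrivially with `γ`; translating the summation variable by `α`
multiplies the sum by a number different from `1`. -/
theorem sum_eQ_pairing [Fintype L.Disc] [DecidableEq L.Disc]
    (hL : ∀ γ, (∀ β, L.pairing β γ = 0) → γ = 0) (γ : L.Disc) :
    ∑ β, eQ (L.pairing β γ) = if γ = 0 then (Nat.card L.Disc : ℂ) else 0 := by
  split_ifs with h
  · simp [h, Nat.card_eq_fintype_card]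
  · obtain ⟨α, hα⟩ : ∃ α, L.pairing α γ ≠ 0 := by
      by_contra! h'
      exact h (hL γ h')
    have h1 : ∑ β, eQ (L.pairing β γ) = eQ (L.pairing α γ) * ∑ β, eQ (L.pairing β γ) := by
      rw [Finset.mul_sum, ← Equiv.sum_comp (Equiv.addLeft α)]
      exact Finset.sum_congr rfl fun β _ => by simp [pairing_add_left, eQ_add]
    have h2 : eQ (L.pairing α γ) ≠ 1 := fun h' => hα ((eQ_eq_one_iff _).mp h')
    have h3 : (1 - eQ (L.pairing α γ)) * ∑ β, eQ (L.pairing β γ) = 0 := by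
      linear_combination h1
    exact (mul_eq_zero.mp h3).resolve_left (sub_ne_zero.mpr h2.symm)

end EvenLattice

/-! ### Homomorphisms from `SL₂(ℤ)` factoring through `SL₂(ℤ/N)`, for `N = 2, 3` -/

section Relations

variable {G : Type*} [Group G] {N : ℕ} {s t : G}

/-- The image of a matrix in `SL₂(ℤ/N)`, `N = 2, 3`, under the homomorphism `S ↦ s`, `T ↦ t`, read
off from the Bruhat decomposition. -/
def bruhatWord (s t : G) (a b c d : ZMod N) : G :=
  open scoped Classical in
  -- Units are their own inverses here. If `c = 0` the matrix is `a T^(ab)`; otherwise it is `c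
  -- T^(ac) S T^(dc)`. The sign `-1` is represented by `s²`.
  if c = 0 then (if a = 1 then 1 else s ^ 2) * t ^ (a * b).val
  else (if c = 1 then 1 else s ^ 2) * t ^ (a * c).val * s * t ^ (d * c).val

theorem pow_val_add [NeZero N] (ht : t ^ N = 1) (u v : ZMod N) :
    t ^ (u + v).val = t ^ u.val * t ^ v.val := by
  rw [ZMod.val_add, ← pow_add, ← pow_eq_pow_mod _ ht]

theorem pow_val_neg [NeZero N] (ht : t ^ N = 1) (u : ZMod N) :
    t ^ (-u).val = (t ^ u.val)⁻¹ := by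
  rw [eq_inv_iff_mul_eq_one, ← pow_val_add ht, neg_add_cancel, ZMod.val_zero, pow_zero]

/-- `s²` is a power both of `s` and of `st`, so it commutes with `t = s⁻¹(st)`. -/
theorem commute_sq_of_relation (h3 : (s * t) ^ 3 = s ^ 2) : Commute (s ^ 2) t := by
  have h1 : Commute (s ^ 2) (s * t) := h3 ▸ (Commute.refl (s * t)).pow_left 3
  have h2 : Commute (s ^ 2) s := (Commute.refl s).pow_left 2
  simpa using h2.inv_right.mul_right h1

/-- This and the next identity reduce `s t^{±1} s` to words with a single `s` up to the central
`s²`. They are the only rewriting needed for products within the big Bruhat cell. -/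
theorem mul_mul_eq_of_relation (h3 : (s * t) ^ 3 = s ^ 2) : s * t * s = t⁻¹ * s * t⁻¹ := by
  have h := (commute_sq_of_relation h3).inv_right.eq
  have h1 : s * t * s = s ^ 2 * t⁻¹ * s⁻¹ * t⁻¹ := by
    rw [← h3, pow_three]; group
  rw [h1, h]; group

theorem sq_mul_eq_of_relation (h3 : (s * t) ^ 3 = s ^ 2) :
    s ^ 2 * (t * s * t) = s * t⁻¹ * s := by
  have h1 : t * s * t = s⁻¹ * (s * t) ^ 3 * t⁻¹ * s⁻¹ := by rw [pow_three]; group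
  have h := (commute_sq_of_relation h3).inv_right.eq
  rw [h1, h3]
  calc s ^ 2 * (s⁻¹ * s ^ 2 * t⁻¹ * s⁻¹) = s * (s ^ 2 * t⁻¹) * s⁻¹ := by group
    _ = s * t⁻¹ * s := by rw [h]; group

variable [NeZero N] [Fact (1 < N)] (hN : ∀ u : ZMod N, u ≠ 0 → u = 1 ∨ u = -1)
include hN

theorem bruhatWord_mul_T (ht : t ^ N = 1) {a b c d : ZMod N} (hdet : a * d - b * c = 1) :
    bruhatWord s t a (a + b) c (c + d) = bruhatWord s t a b c d * t := by
  have hsq : ∀ u : ZMod N, u ≠ 0 → u * u = 1 := fun u hu => by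
    rcases hN u hu with rfl | rfl <;> ring
  have h1 : t ^ (1 : ZMod N).val = t := by rw [ZMod.val_one, pow_one]
  unfold bruhatWord
  by_cases hc : c = 0
  · have ha : a ≠ 0 := by
      rintro rfl
      simp [hc] at hdet
    rw [if_pos hc, if_pos hc, mul_add, hsq a ha, add_comm, pow_val_add ht, h1, mul_assoc]
  · rw [if_neg hc, if_neg hc, add_mul, hsq c hc, add_comm, pow_val_add ht, h1]
    simp only [mul_assoc]

/-- If `c = 0` the word simply acquires an `s`. If `d = 0` the final `s · s` is a central sign.
Otherwise `d = ±c`, so `s` is separated from the new `s` by `t^{±1}`, and one of the two reductions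
above applies. -/
theorem bruhatWord_mul_S (h4 : s ^ 4 = 1) (h3 : (s * t) ^ 3 = s ^ 2) (ht : t ^ N = 1)
    (hs : (1 : ZMod N) = -1 → s ^ 2 = 1) {a b c d : ZMod N} (hdet : a * d - b * c = 1) :
    bruhatWord s t b (-a) d (-c) = bruhatWord s t a b c d * s := by
  classical
  have hsq : ∀ u : ZMod N, u ≠ 0 → u * u = 1 := fun u hu => by
    rcases hN u hu with rfl | rfl <;> ring
  have h1 : t ^ (1 : ZMod N).val = t := by rw [ZMod.val_one, pow_one]
  -- When `1 = -1` in `ZMod N` both signs have the same representative, which is consistent only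
  -- because `s² = 1` is then assumed.
  have hsgn : ∀ u : ZMod N, u ≠ 0 →
      (if -u = 1 then 1 else s ^ 2) = (if u = 1 then 1 else s ^ 2) * s ^ 2 := fun u hu => by
    have h4' : s ^ 2 * s ^ 2 = 1 := by rw [← pow_add, h4]
    rcases hN u hu with rfl | rfl
    · by_cases h : (-1 : ZMod N) = 1
      · simp [hs h.symm]
      · simp [h]
    · by_cases h : (-1 : ZMod N) = 1
      · simp [hs h.symm]
      · simp [h, h4']
  have hcomm : ∀ n : ℕ, s ^ 2 * t ^ n = t ^ n * s ^ 2 := fun n =>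
    ((commute_sq_of_relation h3).pow_right n).eq
  unfold bruhatWord
  by_cases hc : c = 0
  · subst hc
    have hd : d ≠ 0 := by
      rintro rfl
      simp at hdet
    have ha : a = d := by
      have := hsq d hd
      linear_combination d * hdet - a * this
    subst ha
    rw [if_neg hd, if_pos rfl]
    simp [mul_comm b]
  · by_cases hd : d = 0
    · subst hd
      have hb : b = -c := by
        have := hsq c hc
        linear_combination -c * hdet - b * this
      subst hb
      rw [if_pos rfl, if_neg hc, hsgn c hc, zero_mul, ZMod.val_zero, pow_zero, mul_one,
        show -c * -a = a * c by ring, mul_assoc, hcomm]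
      simp only [mul_assoc, pow_two]
    · rw [if_neg hd, if_neg hc]
      have hcc := hsq c hc
      have hdc : d = c ∨ d = -c := by
        rcases hN c hc with rfl | rfl
        · exact hN d hd
        · simpa using (hN d hd).symm
      rcases hdc with rfl | rfl
      · rw [show b * d = a * d + -1 by linear_combination -hdet,
          show -d * d = -1 by linear_combination -hcc, hcc, pow_val_add ht, pow_val_neg ht, h1]
        have := mul_mul_eq_of_relation h3
        simp only [mul_assoc] at this ⊢
        rw [this]
      · rw [show b * -c = a * c + 1 by linear_combination hdet,
          show -c * -c = 1 by linear_combination hcc,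
          show -c * c = -1 by linear_combination -hcc,
          pow_val_add ht, pow_val_neg ht, h1, hsgn c hc]
        have := sq_mul_eq_of_relation h3
        have h2 := hcomm (a * c).val
        calc _ = (if c = 1 then 1 else s ^ 2) * (s ^ 2 * t ^ (a * c).val) * (t * s * t) := by
              simp only [mul_assoc]
          _ = (if c = 1 then 1 else s ^ 2) * t ^ (a * c).val * (s ^ 2 * (t * s * t)) := by
              rw [h2]; simp only [mul_assoc]
          _ = _ := by rw [this]; simp only [mul_assoc]

/-- The normal form turns right multiplication by `S` and `T` into right multiplication by `s` and
`t`. Since `S` and `T` generate, induction on the right factor gives multiplicativity. The normal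
form sees only the entries modulo `N`, so `Γ(N)` is in the kernel. -/
theorem exists_hom_of_relations (h4 : s ^ 4 = 1) (h3 : (s * t) ^ 3 = s ^ 2) (ht : t ^ N = 1)
    (hs : (1 : ZMod N) = -1 → s ^ 2 = 1) :
    ∃ φ : SL(2, ℤ) →* G, φ ModularGroup.S = s ∧ φ ModularGroup.T = t ∧
      ∀ M ∈ CongruenceSubgroup.Gamma N, φ M = 1 := by
  let f : SL(2, ℤ) → G := fun M => bruhatWord s t ((M 0 0 : ℤ) : ZMod N) ((M 0 1 : ℤ) : ZMod N)
    ((M 1 0 : ℤ) : ZMod N) ((M 1 1 : ℤ) : ZMod N)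
  have hdet : ∀ M : SL(2, ℤ), ((M 0 0 : ℤ) : ZMod N) * ((M 1 1 : ℤ) : ZMod N) -
      ((M 0 1 : ℤ) : ZMod N) * ((M 1 0 : ℤ) : ZMod N) = 1 := fun M => by
    have := M.det_coe
    rw [Matrix.det_fin_two] at this
    exact_mod_cast congrArg (Int.cast : ℤ → ZMod N) this
  have hf1 : f 1 = 1 := by simp [f, bruhatWord]
  have hfS : ∀ M, f (M * ModularGroup.S) = f M * s := fun M => by
    rw [← bruhatWord_mul_S hN h4 h3 ht hs (hdet M)]
    simp [f, Matrix.SpecialLinearGroup.coe_mul, ModularGroup.coe_S, Matrix.mul_apply,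
      Fin.sum_univ_two]
  have hfT : ∀ M, f (M * ModularGroup.T) = f M * t := fun M => by
    rw [← bruhatWord_mul_T hN ht (hdet M)]
    simp [f, Matrix.SpecialLinearGroup.coe_mul, ModularGroup.coe_T, Matrix.mul_apply,
      Fin.sum_univ_two]
  have hmul : ∀ M M' : SL(2, ℤ), f (M * M') = f M * f M' := fun M M' => by
    have hM' : M' ∈ Subgroup.closure {ModularGroup.S, ModularGroup.T} := by
      simp [SpecialLinearGroup.SL2Z_generators]
    induction hM' using Subgroup.closure_induction generalizing M with
    | one => simp [hf1]
    | mem x hx =>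
      rcases hx with rfl | rfl
      · rw [hfS, ← one_mul ModularGroup.S, hfS, hf1, one_mul]
      · rw [hfT, ← one_mul ModularGroup.T, hfT, hf1, one_mul]
    | mul x y _ _ hx hy => rw [← mul_assoc, hy, hx, hy x, mul_assoc]
    | inv x _ hx =>
      have h1 := hx (M * x⁻¹)
      have h2 := hx x⁻¹
      rw [inv_mul_cancel_right] at h1
      rw [inv_mul_cancel, hf1] at h2
      rw [h1, mul_assoc, mul_eq_one_iff_eq_inv.mp h2.symm, mul_inv_cancel, mul_one]
  refine ⟨MonoidHom.mk' f hmul, ?_, ?_, fun M hM => ?_⟩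
  · change f ModularGroup.S = s
    rw [← one_mul ModularGroup.S, hfS, hf1, one_mul]
  · change f ModularGroup.T = t
    rw [← one_mul ModularGroup.T, hfT, hf1, one_mul]
  · obtain ⟨h00, h01, h10, h11⟩ := CongruenceSubgroup.Gamma_mem.mp hM
    change bruhatWord s t _ _ _ _ = 1
    rw [h00, h01, h10, h11]
    simp [bruhatWord]

end Relations

namespace EvenLattice

variable {V : Type*} [AddCommGroup V] [Module ℚ V] {L : EvenLattice V}

/-! ### The Weil representation -/

theorem basisVec_apply [DecidableEq L.Disc] (γ δ : L.Disc) :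
    L.basisVec γ δ = if δ = γ then 1 else 0 := by
  unfold basisVec
  split_ifs <;> rfl

theorem linearMap_ext_basisVec [Finite L.Disc] {W : Type*} [AddCommMonoid W] [Module ℂ W]
    {f g : (L.Disc → ℂ) →ₗ[ℂ] W} (h : ∀ γ, f (L.basisVec γ) = g (L.basisVec γ)) : f = g := by
  classical
  refine (Pi.basisFun ℂ L.Disc).ext fun γ => ?_
  have : Pi.basisFun ℂ L.Disc γ = L.basisVec γ := by
    ext δ
    rw [Pi.basisFun_apply, basisVec_apply, Pi.single_apply]
  rw [this, h]

variable (L) in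
/-- The action of `T` on `ℂ[D]`. -/
noncomputable def weilT : Module.End ℂ (L.Disc → ℂ) where
  toFun v δ := eQ (L.Q δ) * v δ
  map_add' v w := by ext δ; simp [mul_add]
  map_smul' a v := by ext δ; simp [mul_left_comm]

variable (L) in
/-- The constant `e(-r/8) / √|D|`. -/
noncomputable def weilConst : ℂ := e (-(L.sigDiff : ℂ) / 8) / (Real.sqrt (Nat.card L.Disc) : ℂ)

variable (L) in
/-- The action of `S` on `ℂ[D]`. -/
noncomputable def weilS [Fintype L.Disc] : Module.End ℂ (L.Disc → ℂ) where
  toFun v β := L.weilConst * ∑ γ, eQ (-L.pairing γ β) * v γ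
  map_add' v w := by ext β; simp [mul_add, Finset.sum_add_distrib]
  map_smul' a v := by
    ext β
    simp only [Pi.smul_apply, smul_eq_mul, RingHom.id_apply, Finset.mul_sum]
    exact Finset.sum_congr rfl fun γ _ => by ring

theorem weilT_apply (v : L.Disc → ℂ) (δ : L.Disc) : L.weilT v δ = eQ (L.Q δ) * v δ := rfl

theorem weilS_apply [Fintype L.Disc] (v : L.Disc → ℂ) (β : L.Disc) :
    L.weilS v β = L.weilConst * ∑ γ, eQ (-L.pairing γ β) * v γ := rfl

theorem isWeilRepresentation_iff [Fintype L.Disc]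
    (ρ : Representation ℂ SL(2, ℤ) (L.Disc → ℂ)) :
    L.IsWeilRepresentation ρ ↔ ρ ModularGroup.S = L.weilS ∧ ρ ModularGroup.T = L.weilT := by
  classical
  have hT : ∀ γ, L.weilT (L.basisVec γ) = eQ (L.Q γ) • L.basisVec γ := fun γ => by
    ext δ
    rw [weilT_apply, Pi.smul_apply, smul_eq_mul, basisVec_apply]
    split_ifs with h
    · rw [h]
    · simp
  have hS : ∀ γ β, L.weilS (L.basisVec γ) β = L.weilConst * eQ (-L.pairing γ β) := fun γ β => by
    simp [weilS_apply, basisVec_apply]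
  constructor
  · rintro ⟨h1, h2⟩
    refine ⟨linearMap_ext_basisVec fun γ => ?_, linearMap_ext_basisVec fun γ => ?_⟩
    · ext β
      rw [h2, hS, weilConst, pairing_comm]
    · rw [h1, hT]
  · rintro ⟨h1, h2⟩
    refine ⟨fun γ => by rw [h2, hT], fun γ β => by rw [h1, hS, weilConst, pairing_comm]⟩

theorem IsWeilRepresentation.unique [Finite L.Disc]
    {ρ ρ' : Representation ℂ SL(2, ℤ) (L.Disc → ℂ)}
    (h : L.IsWeilRepresentation ρ) (h' : L.IsWeilRepresentation ρ') : ρ = ρ' := by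
  have := Fintype.ofFinite L.Disc
  rw [isWeilRepresentation_iff] at h h'
  refine MonoidHom.eq_of_eqOn_dense SpecialLinearGroup.SL2Z_generators ?_
  rintro x (rfl | rfl)
  · rw [h.1, h'.1]
  · rw [h.2, h'.2]

section Nice

variable {N : ℕ} {k : ℤ} (hL : L.IsNiceOfLevel N) (hk : L.sigDiff = 2 * k)
include hL

/-- As `N` kills `Q`, it kills the pairing, so `Nγ` lies in the radical, which is zero. -/
theorem IsNiceOfLevel.nsmul_eq_zero (γ : L.Disc) : N • γ = 0 := by
  refine hL.nondegenerate _ fun β => ?_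
  have h : ∀ n : ℕ, L.pairing β (n • γ) = n • L.pairing β γ := fun n => by
    induction n with
    | zero => simp
    | succ n ih => rw [succ_nsmul, pairing_add_right, ih, succ_nsmul]
  rw [h, pairing, nsmul_sub, nsmul_sub, hL.nsmul_Q, hL.nsmul_Q, hL.nsmul_Q]
  simp

theorem IsNiceOfLevel.sqrt_card_ne_zero : (Real.sqrt (Nat.card L.Disc) : ℂ) ≠ 0 := by
  have := hL.finite
  have h : 0 < Nat.card L.Disc := Nat.card_pos
  exact_mod_cast (Real.sqrt_pos.mpr (by exact_mod_cast h)).ne'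

theorem IsNiceOfLevel.weilConst_mul_gauss [Fintype L.Disc] :
    L.weilConst * ∑ γ, eQ (L.Q γ) = 1 := by
  rw [← finsum_eq_sum_of_fintype, hL.gauss_sum, weilConst]
  have h := hL.sqrt_card_ne_zero
  field_simp
  rw [← e_add, neg_add_cancel, e_zero]

include hk in
theorem IsNiceOfLevel.weilConst_sq : L.weilConst * L.weilConst * Nat.card L.Disc = (-1) ^ k := by
  have h := hL.sqrt_card_ne_zero
  have h1 : (Real.sqrt (Nat.card L.Disc) : ℂ) * (Real.sqrt (Nat.card L.Disc) : ℂ)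
      = Nat.card L.Disc := by
    rw [← Complex.ofReal_mul, Real.mul_self_sqrt (Nat.cast_nonneg _)]
    simp
  rw [← h1, weilConst, hk]
  field_simp
  -- The left side is `exp(-πik)` and the right side `exp(πik)`; they differ by the factor
  -- `exp(-2πik) = 1`.
  rw [pow_two, ← e_add, e, ← Complex.exp_pi_mul_I, ← Complex.exp_int_mul,
    ← mul_one (Complex.exp ((k : ℂ) * _)), ← Complex.exp_int_mul_two_pi_mul_I (-k), ← Complex.exp_add]
  congr 1
  push_cast
  ring

theorem IsNiceOfLevel.weilT_pow : L.weilT ^ N = 1 := by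
  have h : ∀ (n : ℕ) v δ, (L.weilT ^ n) v δ = eQ (n • L.Q δ) * v δ := fun n => by
    induction n with
    | zero => simp
    | succ n ih =>
      intro v δ
      rw [pow_succ', Module.End.mul_apply, weilT_apply, ih, succ_nsmul', eQ_add, mul_assoc]
  ext1 v
  ext δ
  rw [h, hL.nsmul_Q]
  simp

include hk in
-- In the double sum, orthogonality over the intermediate variable `α` leaves only `γ = -β`; the
-- remaining constant is `weilConst_sq`.
theorem IsNiceOfLevel.weilS_sq_apply [Fintype L.Disc] (v : L.Disc → ℂ) (β : L.Disc) :
    (L.weilS ^ 2) v β = (-1) ^ k * v (-β) := by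
  classical
  rw [pow_two, Module.End.mul_apply, weilS_apply]
  simp_rw [weilS_apply, Finset.mul_sum]
  rw [Finset.sum_comm]
  have h1 : ∀ γ : L.Disc, ∑ α, L.weilConst * (eQ (-L.pairing α β) *
      (L.weilConst * (eQ (-L.pairing γ α) * v γ))) =
      if γ = -β then (-1) ^ k * v (-β) else 0 := fun γ => by
    have h2 : ∀ α, L.weilConst * (eQ (-L.pairing α β) *
      (L.weilConst * (eQ (-L.pairing γ α) * v γ))) =
        L.weilConst * L.weilConst * v γ * eQ (L.pairing α (-(β + γ))) := fun α => by
      rw [pairing_neg_right, pairing_add_right, neg_add, eQ_add, pairing_comm L γ]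
      ring
    simp_rw [h2]
    rw [← Finset.mul_sum, sum_eQ_pairing hL.nondegenerate, neg_eq_zero]
    by_cases h : γ = -β
    · rw [if_pos h, if_pos (by rw [h, add_neg_cancel]), h, ← hL.weilConst_sq hk]
      ring
    · rw [if_neg h, if_neg (fun h' => h (eq_neg_of_add_eq_zero_right h')), mul_zero]
  simp_rw [h1]
  simp

include hk in
theorem IsNiceOfLevel.weilS_pow_four [Fintype L.Disc] : L.weilS ^ 4 = 1 := by
  ext1 v
  ext β
  rw [show 4 = 2 + 2 from rfl, pow_add, Module.End.mul_apply, hL.weilS_sq_apply hk,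
    hL.weilS_sq_apply hk, ← mul_assoc, ← mul_zpow]
  simp

/-- This is `(st)³ = s²` in the form `tstst = s`. Completing the square collects the phases into
`Q(α - (β + γ))` and `-(γ, β)`; the sum over `α` is then a translated Gauss sum, which `weilConst`
normalizes to `1`. -/
theorem IsNiceOfLevel.weilT_mul_weilS_mul_weilT [Fintype L.Disc] :
    L.weilT * L.weilS * L.weilT * L.weilS * L.weilT = L.weilS := by
  ext1 v
  ext β
  simp only [Module.End.mul_apply]
  rw [weilT_apply, weilS_apply, weilS_apply]
  simp_rw [weilT_apply, weilS_apply, weilT_apply, Finset.mul_sum]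
  rw [Finset.sum_comm]
  refine Finset.sum_congr rfl fun γ _ => ?_
  have hR : L.weilConst * (eQ (-L.pairing γ β) * v γ) = ∑ α, L.weilConst * L.weilConst *
      eQ (L.Q (α - (β + γ))) * (eQ (-L.pairing γ β) * v γ) := by
    have h := Equiv.sum_comp (Equiv.subRight (β + γ)) (fun α => eQ (L.Q α))
    simp only [Equiv.subRight_apply] at h
    rw [← Finset.sum_mul, ← Finset.mul_sum, mul_assoc L.weilConst, h, hL.weilConst_mul_gauss,
      mul_one]
  rw [hR]
  refine Finset.sum_congr rfl fun α _ => ?_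
  have h : L.Q (α - (β + γ)) + -L.pairing γ β =
      L.Q β + (-L.pairing α β + (L.Q α + (-L.pairing γ α + L.Q γ))) := by
    rw [sub_eq_add_neg, Q_add, Q_neg, Q_add, pairing_neg_right, pairing_add_right,
      L.pairing_comm γ α, L.pairing_comm γ β]
    abel
  calc _ = L.weilConst * L.weilConst * v γ *
        eQ (L.Q β + (-L.pairing α β + (L.Q α + (-L.pairing γ α + L.Q γ)))) := by
        simp only [eQ_add]; ring
    _ = _ := by rw [← h, eQ_add]; ring

variable [NeZero N] [Fact (1 < N)] (hN : ∀ u : ZMod N, u ≠ 0 → u = 1 ∨ u = -1)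
  (hev : (1 : ZMod N) = -1 → Even k)
include hk hN hev

theorem IsNiceOfLevel.exists_isWeilRepresentation :
    ∃ ρ : Representation ℂ SL(2, ℤ) (L.Disc → ℂ), L.IsWeilRepresentation ρ ∧
      ∀ M ∈ CongruenceSubgroup.Gamma N, ρ M = 1 := by
  have := hL.finite
  have := Fintype.ofFinite L.Disc
  let s : (Module.End ℂ (L.Disc → ℂ))ˣ := Units.ofPowEqOne L.weilS 4 (hL.weilS_pow_four hk) (by simp)
  let t : (Module.End ℂ (L.Disc → ℂ))ˣ := Units.ofPowEqOne L.weilT N hL.weilT_pow (NeZero.ne N)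
  have hs4 : s ^ 4 = 1 := Units.ext (hL.weilS_pow_four hk)
  have htN : t ^ N = 1 := Units.ext hL.weilT_pow
  have h3 : (s * t) ^ 3 = s ^ 2 := by
    have : t * s * t * s * t = s := Units.ext hL.weilT_mul_weilS_mul_weilT
    calc (s * t) ^ 3 = s * (t * s * t * s * t) := by rw [pow_three]; simp only [mul_assoc]
      _ = s ^ 2 := by rw [this, pow_two]
  have hs2 : (1 : ZMod N) = -1 → s ^ 2 = 1 := fun h => by
    refine Units.ext (LinearMap.ext fun v => funext fun β => ?_)
    have hN2 : N = 2 := by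
      have h2 : ((2 : ℕ) : ZMod N) = 0 := by
        push_cast
        linear_combination h
      have := Nat.le_of_dvd two_pos ((ZMod.natCast_eq_zero_iff 2 N).mp h2)
      have : 1 < N := Fact.out
      omega
    have hβ : -β = β := by
      have := hL.nsmul_eq_zero β
      rw [hN2, two_nsmul] at this
      exact neg_eq_of_add_eq_zero_left this
    -- For `N = 2` the map `β ↦ -β` is the identity and `k` is even, so `S²` acts trivially.
    change (L.weilS ^ 2) v β = v β
    rw [hL.weilS_sq_apply hk, (hev h).neg_one_zpow, one_mul, hβ]
  obtain ⟨φ, hφS, hφT, hφ⟩ := exists_hom_of_relations hN hs4 h3 htN hs2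
  refine ⟨(Units.coeHom _).comp φ, (isWeilRepresentation_iff _).mpr ⟨?_, ?_⟩, fun M hM => ?_⟩
  · change ((φ ModularGroup.S : (Module.End ℂ (L.Disc → ℂ))ˣ) : Module.End ℂ (L.Disc → ℂ)) = _
    rw [hφS]; rfl
  · change ((φ ModularGroup.T : (Module.End ℂ (L.Disc → ℂ))ˣ) : Module.End ℂ (L.Disc → ℂ)) = _
    rw [hφT]; rfl
  · change ((φ M : (Module.End ℂ (L.Disc → ℂ))ˣ) : Module.End ℂ (L.Disc → ℂ)) = _
    rw [hφ M hM]; rfl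

theorem IsNiceOfLevel.existsUnique_isWeilRepresentation :
    ∃! ρ : Representation ℂ SL(2, ℤ) (L.Disc → ℂ), L.IsWeilRepresentation ρ := by
  have := hL.finite
  obtain ⟨ρ, hρ, -⟩ := hL.exists_isWeilRepresentation hk hN hev
  exact ⟨ρ, hρ, fun ρ' hρ' => hρ'.unique hρ⟩

theorem IsNiceOfLevel.apply_eq_one_of_mem_Gamma
    {ρ : Representation ℂ SL(2, ℤ) (L.Disc → ℂ)} (hρ : L.IsWeilRepresentation ρ)
    {M : SL(2, ℤ)} (hM : M ∈ CongruenceSubgroup.Gamma N) : ρ M = 1 := by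
  have := hL.finite
  obtain ⟨ρ', hρ', h⟩ := hL.exists_isWeilRepresentation hk hN hev
  rw [hρ.unique hρ', h M hM]

end Nice

end EvenLattice

open ModularGroup CongruenceSubgroup

/-! ### The group `Γ₁(N)` for `N = 2, 3` -/

theorem exists_two_mul_abs_add_mul_le {c : ℤ} (hc : c ≠ 0) (d : ℤ) :
    ∃ n : ℤ, 2 * |d + n * c| ≤ |c| := by
  have h1 := Int.emod_add_mul_ediv d c
  have h2 := Int.emod_nonneg d hc
  have h3 := Int.emod_lt_abs d hc
  rcases le_total (2 * (d % c)) |c| with h | h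
  · refine ⟨-(d / c), ?_⟩
    rw [show d + -(d / c) * c = d % c by linear_combination -h1, abs_of_nonneg h2]
    exact h
  · refine ⟨-(d / c) - c.sign, ?_⟩
    have h4 : d + (-(d / c) - c.sign) * c = d % c - |c| := by
      rw [← Int.sign_mul_self_eq_abs]
      linear_combination -h1
    rw [h4, abs_of_nonpos (by omega)]
    omega

theorem coe_S_mul_T_zpow_mul_S_inv (n : ℤ) :
    ((S * T ^ n * S⁻¹ : SL(2, ℤ)) : Matrix (Fin 2) (Fin 2) ℤ) = !![1, 0; -n, 1] := by
  rw [Matrix.SpecialLinearGroup.coe_mul, Matrix.SpecialLinearGroup.coe_mul,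
    Matrix.SpecialLinearGroup.coe_inv, coe_S, coe_T_zpow, Matrix.adjugate_fin_two_of]
  simp

theorem coe_S_sq : ((S ^ 2 : SL(2, ℤ)) : Matrix (Fin 2) (Fin 2) ℤ) = !![-1, 0; 0, -1] := by
  rw [pow_two, Matrix.SpecialLinearGroup.coe_mul, coe_S]
  simp

theorem S_sq : S ^ 2 = -1 := by
  ext i j
  rw [coe_S_sq]
  fin_cases i <;> fin_cases j <;> simp

/-- Euclidean descent on the bottom row `(c, d)`. Multiplying by a power of `T` achieves `2|d| ≤
|c|`, and then by a power of `S T^N S⁻¹` achieves `2|c'| ≤ N|d|`; hence `|c'| ≤ N|c|/4 < |c|`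
because `N < 4`. At `c = 0` the matrix is `±T^b`, and the sign `-1` is possible only for `N = 2`. -/
theorem Gamma1_le {N : ℕ} (hN : N = 2 ∨ N = 3) {H : Subgroup SL(2, ℤ)} (hT : T ∈ H)
    (hV : S * T ^ N * S⁻¹ ∈ H) (hS : N = 2 → S ^ 2 ∈ H) : Gamma1 N ≤ H := by
  have hVz : ∀ m : ℤ, S * T ^ ((N : ℤ) * m) * S⁻¹ ∈ H := fun m => by
    have := H.zpow_mem hV m
    rwa [conj_zpow, ← zpow_natCast, ← zpow_mul] at this
  intro A hA
  induction hn : (A 1 0).natAbs using Nat.strong_induction_on generalizing A with | _ n ih => ?_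
  obtain ⟨h00, h11, h10⟩ := (Gamma1_mem N A).mp hA
  have hdet := A.det_coe
  rw [Matrix.det_fin_two] at hdet
  obtain ⟨x, hx⟩ : (N : ℤ) ∣ A 1 1 - 1 := by
    rw [← ZMod.intCast_zmod_eq_zero_iff_dvd _ N]
    push_cast
    rw [h11, sub_self]
  by_cases hc : A 1 0 = 0
  · rw [hc, mul_zero, sub_zero] at hdet
    rcases Int.eq_one_or_neg_one_of_mul_eq_one' hdet with ⟨ha, hd⟩ | ⟨ha, hd⟩
    · have : A = T ^ (A 0 1) := by
        ext i j
        rw [coe_T_zpow]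
        fin_cases i <;> fin_cases j <;> simp [ha, hd, hc]
      rw [this]
      exact H.zpow_mem hT _
    · have hN2 : N = 2 := by
        rcases hN with rfl | rfl
        · rfl
        · rw [hd] at hx; omega
      have : A = S ^ 2 * T ^ (-(A 0 1)) := by
        ext i j
        rw [Matrix.SpecialLinearGroup.coe_mul, coe_S_sq, coe_T_zpow]
        fin_cases i <;> fin_cases j <;> simp [ha, hd, hc]
      rw [this]
      exact H.mul_mem (hS hN2) (H.zpow_mem hT _)
  · obtain ⟨n, hn'⟩ := exists_two_mul_abs_add_mul_le hc (A 1 1)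
    -- The new `d` is congruent to `1` modulo `N`, so it cannot vanish.
    have hne : (N : ℤ) * (A 1 1 + n * A 1 0) ≠ 0 := by
      have hN0 : (N : ℤ) ≠ 0 := by rcases hN with rfl | rfl <;> norm_num
      refine mul_ne_zero hN0 fun h => ?_
      have h' := congrArg (Int.cast : ℤ → ZMod N) h
      push_cast at h'
      rw [h11, h10, mul_zero, add_zero] at h'
      rcases hN with rfl | rfl
      · exact absurd h' (by decide)
      · exact absurd h' (by decide)
    obtain ⟨m, hm⟩ := exists_two_mul_abs_add_mul_le hne (A 1 0)
    set B := A * T ^ n * (S * T ^ ((N : ℤ) * -m) * S⁻¹) with hB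
    have hB10 : B 1 0 = A 1 0 + m * (N * (A 1 1 + n * A 1 0)) := by
      rw [hB, Matrix.SpecialLinearGroup.coe_mul, Matrix.SpecialLinearGroup.coe_mul, coe_T_zpow,
        coe_S_mul_T_zpow_mul_S_inv]
      simp [Matrix.mul_apply, Fin.sum_univ_two]
      ring
    have hB1 : B ∈ Gamma1 N := by
      refine mul_mem (mul_mem hA ?_) ?_
      · rw [Gamma1_mem, coe_T_zpow]; simp
      · rw [Gamma1_mem, coe_S_mul_T_zpow_mul_S_inv]; simp
    have hlt : (B 1 0).natAbs < (A 1 0).natAbs := by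
      rw [← hB10, abs_mul] at hm
      rcases hN with rfl | rfl <;> zify <;> have := abs_pos.mpr hc <;> push_cast at hm <;>
        norm_num at hm <;> linarith
    have hBH := ih _ (hn ▸ hlt) hB1 rfl
    have hA' : A = B * (S * T ^ ((N : ℤ) * -m) * S⁻¹)⁻¹ * (T ^ n)⁻¹ := by
      rw [hB]; group
    rw [hA']
    exact H.mul_mem (H.mul_mem hBH (H.inv_mem (hVz _))) (H.inv_mem (H.zpow_mem hT _))

/-- The reduction modulo `N` of the bottom row of `M`. -/
def bottomRow (N : ℕ) (M : SL(2, ℤ)) : ZMod N × ZMod N := ((M 1 0 : ℤ), (M 1 1 : ℤ))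

/-- Membership says that the bottom row of `M' M⁻¹` is `(0, 1)` modulo `N`, the upper left entry `1`
being forced by the determinant. Multiplying by `M` on the right turns this into equality of bottom
rows. -/
theorem mul_inv_mem_Gamma1_iff {N : ℕ} (M M' : SL(2, ℤ)) :
    M' * M⁻¹ ∈ Gamma1 N ↔ bottomRow N M = bottomRow N M' := by
  have hdet := M.det_coe
  have hdet' := M'.det_coe
  rw [Matrix.det_fin_two] at hdet hdet'
  replace hdet := congrArg (Int.cast : ℤ → ZMod N) hdet
  replace hdet' := congrArg (Int.cast : ℤ → ZMod N) hdet'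
  push_cast at hdet hdet'
  rw [Gamma1_mem, Matrix.SpecialLinearGroup.coe_mul, Matrix.SpecialLinearGroup.coe_inv,
    Matrix.adjugate_fin_two]
  simp only [bottomRow, Prod.mk.injEq, Matrix.mul_apply, Fin.sum_univ_two, Matrix.of_apply,
    Matrix.cons_val', Matrix.cons_val_zero, Matrix.cons_val_one, Matrix.cons_val_fin_one]
  push_cast
  generalize ((M 0 0 : ℤ) : ZMod N) = a at *
  generalize ((M 0 1 : ℤ) : ZMod N) = b at *
  generalize ((M 1 0 : ℤ) : ZMod N) = c at *
  generalize ((M 1 1 : ℤ) : ZMod N) = d at *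
  generalize ((M' 0 0 : ℤ) : ZMod N) = a' at *
  generalize ((M' 0 1 : ℤ) : ZMod N) = b' at *
  generalize ((M' 1 0 : ℤ) : ZMod N) = c' at *
  generalize ((M' 1 1 : ℤ) : ZMod N) = d' at *
  constructor
  · rintro ⟨h1, h2, h3⟩
    constructor
    · linear_combination -a * h3 - c * h2 + c' * hdet
    · linear_combination -b * h3 - d * h2 + d' * hdet
  · rintro ⟨rfl, rfl⟩
    refine ⟨?_, ?_, ?_⟩
    · linear_combination hdet'
    · linear_combination hdet
    · ring

/-- Representatives of the cosets `Γ₁(N) M`, for `N = 2, 3`. -/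
def cosetRep (N : ℕ) : Fin (N - 1) × Option (Fin N) → SL(2, ℤ)
  | (i, none) => (S ^ 2) ^ (i : ℕ)
  | (i, some j) => (S ^ 2) ^ (i : ℕ) * (S * T ^ (j : ℕ))

theorem coe_S_sq_pow (i : ℕ) :
    (((S ^ 2) ^ i : SL(2, ℤ)) : Matrix (Fin 2) (Fin 2) ℤ) = !![(-1) ^ i, 0; 0, (-1) ^ i] := by
  induction i with
  | zero => ext i j; fin_cases i <;> fin_cases j <;> simp
  | succ n ih =>
    rw [pow_succ, Matrix.SpecialLinearGroup.coe_mul, ih, coe_S_sq]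
    simp [pow_succ]

theorem coe_S_mul_T_pow (j : ℕ) :
    ((S * T ^ j : SL(2, ℤ)) : Matrix (Fin 2) (Fin 2) ℤ) = !![0, -1; 1, (j : ℤ)] := by
  rw [← zpow_natCast, Matrix.SpecialLinearGroup.coe_mul, coe_S, coe_T_zpow]
  simp

theorem bottomRow_cosetRep (N : ℕ) (x : Fin (N - 1) × Option (Fin N)) :
    bottomRow N (cosetRep N x) =
      ((-1) ^ (x.1 : ℕ) * (x.2.elim 0 fun _ => 1),
        (-1) ^ (x.1 : ℕ) * (x.2.elim 1 fun j => ((j : ℕ) : ZMod N))) := by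
  obtain ⟨i, _ | j⟩ := x
  · simp only [bottomRow, cosetRep, coe_S_sq_pow]
    simp
  · simp only [bottomRow, cosetRep, Matrix.SpecialLinearGroup.coe_mul, coe_S_sq_pow]
    rw [← Matrix.SpecialLinearGroup.coe_mul, coe_S_mul_T_pow]
    simp

/-- The bottom rows `±(0, 1)` and `±(1, j)` exhaust the nonzero vectors of `(ℤ/N)²` without
repetition; the count is `N² - 1 = (N - 1)(N + 1)`. For `N = 2` only the sign `+` occurs. -/
theorem bijective_mk_cosetRep {N : ℕ} (hN : N = 2 ∨ N = 3) :
    Function.Bijective (fun x => (⟦cosetRep N x⟧ : Quotient (QuotientGroup.rightRel (Gamma1 N)))) := by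
  have key : ∀ c d : ZMod N, ¬(c = 0 ∧ d = 0) → ∃! x : Fin (N - 1) × Option (Fin N),
      ((-1) ^ (x.1 : ℕ) * (x.2.elim 0 fun _ => 1),
        (-1) ^ (x.1 : ℕ) * (x.2.elim 1 fun j => ((j : ℕ) : ZMod N))) = (c, d) := by
    unfold ExistsUnique
    rcases hN with rfl | rfl <;> decide
  have hrow : ∀ M : SL(2, ℤ), ¬((bottomRow N M).1 = 0 ∧ (bottomRow N M).2 = 0) := by
    rintro M ⟨h1, h2⟩
    have hdet := M.det_coe
    rw [Matrix.det_fin_two] at hdet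
    replace hdet := congrArg (Int.cast : ℤ → ZMod N) hdet
    simp only [bottomRow] at h1 h2
    push_cast at hdet
    rw [h1, h2] at hdet
    rcases hN with rfl | rfl
    · exact absurd hdet (by simp)
    · exact absurd hdet (by simp)
  have hrel : ∀ M M' : SL(2, ℤ),
      (⟦M⟧ : Quotient (QuotientGroup.rightRel (Gamma1 N))) = ⟦M'⟧ ↔
        bottomRow N M = bottomRow N M' := fun M M' => by
    rw [Quotient.eq, QuotientGroup.rightRel_apply, mul_inv_mem_Gamma1_iff]
  constructor
  · intro x y hxy
    have h := (hrel _ _).mp hxy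
    exact (key _ _ (hrow (cosetRep N y))).unique ((bottomRow_cosetRep N x).symm.trans h)
      (bottomRow_cosetRep N y).symm
  · intro q
    induction q using Quotient.inductionOn with | h M => ?_
    obtain ⟨x, hx, -⟩ := key _ _ (hrow M)
    exact ⟨x, (hrel _ _).mpr ((bottomRow_cosetRep N x).trans hx)⟩

/-! ### Expansions with rational exponents -/

/-- `h(τ) = ∑ c(m) e(mτ)`, the sum extending over rational exponents. -/
def HasRatExpansion (c : ℚ → ℂ) (h : ℍ → ℂ) : Prop :=
  ∀ τ : ℍ, HasSum (fun m : ℚ => c m * e ((m : ℂ) * τ)) (h τ)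

theorem hasRatExpansion_extend {b : ℕ → ℂ} {h : ℍ → ℂ} {φ : ℕ → ℚ} (hφ : Function.Injective φ)
    (hb : ∀ τ : ℍ, HasSum (fun n => b n * e ((φ n : ℂ) * τ)) (h τ)) :
    HasRatExpansion (Function.extend φ b 0) h := fun τ => by
  refine (hφ.hasSum_iff fun m hm => ?_).mp ?_
  · rw [Function.extend_apply' _ _ _ (by simpa using hm)]
    simp
  · simpa [Function.comp_def, hφ.extend_apply] using hb τ

/-- For `m ≥ 0` the size of `e(mτ)` decreases with `Im τ`, so on `Im τ ≥ 1` the series is dominated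
by the absolutely convergent one at `τ = i`. -/
theorem HasRatExpansion.isBoundedAtImInfty {c : ℚ → ℂ} {h : ℍ → ℂ} (hc : HasRatExpansion c h)
    (h0 : ∀ m < 0, c m = 0) : UpperHalfPlane.IsBoundedAtImInfty h := by
  rw [UpperHalfPlane.isBoundedAtImInfty_iff]
  have hs : Summable fun m : ℚ => ‖c m * e ((m : ℂ) * (UpperHalfPlane.I : ℍ))‖ :=
    (hc UpperHalfPlane.I).summable.norm
  refine ⟨∑' m : ℚ, ‖c m * e ((m : ℂ) * (UpperHalfPlane.I : ℍ))‖, 1, fun τ hτ => ?_⟩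
  rw [← (hc τ).tsum_eq]
  refine tsum_of_norm_bounded hs.hasSum fun m => ?_
  rcases lt_or_ge m 0 with hm | hm
  · simp [h0 m hm]
  · rw [norm_mul, norm_mul, norm_e, norm_e]
    refine mul_le_mul_of_nonneg_left (Real.exp_le_exp.mpr ?_) (norm_nonneg _)
    have hm' : (0 : ℝ) ≤ m := by exact_mod_cast hm
    have h1 : ((m : ℂ) * (τ : ℂ)).im = m * τ.im := by simp
    have h2 : ((m : ℂ) * ((UpperHalfPlane.I : ℍ) : ℂ)).im = m * 1 := by simp
    rw [h1, h2]
    have := mul_le_mul_of_nonneg_left hτ hm'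
    have := Real.pi_pos
    nlinarith

section Parts

variable {N : ℕ} {a : ℕ → ℂ} {g : ℍ → ℂ} (hg : HasExpansion N a g)
include hg

theorem HasExpansion.hasSum_expansionPart (x : QmodZ) [DecidablePred fun y : QmodZ => y = x] (τ : ℍ) :
    HasSum (fun n : ℕ => if (((n : ℚ) / N : ℚ) : QmodZ) = x then a n * e ((n : ℂ) * τ / N) else 0)
      (expansionPart N a x τ) := by
  have h := ((hg τ).summable.indicator {n : ℕ | (((n : ℚ) / N : ℚ) : QmodZ) = x}).hasSum
  have h1 : expansionPart N a x τ = ∑' n : ℕ, {n : ℕ | (((n : ℚ) / N : ℚ) : QmodZ) = x}.indicator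
      (fun n : ℕ => a n * e ((n : ℂ) * τ / N)) n := by
    unfold expansionPart
    refine tsum_congr fun n => ?_
    simp [Set.indicator_apply]
  rw [h1]
  have h2 : (fun n : ℕ => if (((n : ℚ) / N : ℚ) : QmodZ) = x then a n * e ((n : ℂ) * τ / N) else 0) =
      {n : ℕ | (((n : ℚ) / N : ℚ) : QmodZ) = x}.indicator
        (fun n : ℕ => a n * e ((n : ℂ) * τ / N)) := by
    funext n
    simp [Set.indicator_apply]
  rw [h2]
  exact h

variable [NeZero N]

/-- Translation by `j` multiplies the term of exponent `n/N` by `e(jn/N)`. After twisting by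
`e(-jx)`, orthogonality of characters of `ℤ/N` selects the exponents congruent to `x`. -/
theorem HasExpansion.sum_translates (x : QmodZ) (hx : N • x = 0) (τ : ℍ) :
    ∑ j : Fin N, g (((j : ℕ) : ℝ) +ᵥ τ) * eQ (-((j : ℕ) • x)) = N * expansionPart N a x τ := by
  classical
  have hN : (N : ℂ) ≠ 0 := Nat.cast_ne_zero.mpr (NeZero.ne N)
  have h1 := hasSum_sum (s := Finset.univ) fun (j : Fin N) _ =>
    (hg (((j : ℕ) : ℝ) +ᵥ τ)).mul_right (eQ (-((j : ℕ) • x)))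
  refine h1.unique ?_
  convert (hg.hasSum_expansionPart x τ).mul_left (N : ℂ) using 2 with n
  set y : QmodZ := (((n : ℚ) / N : ℚ) : QmodZ) with hy
  have hNy : N • (y - x) = 0 := by
    rw [nsmul_sub, hx, sub_zero, hy, ← AddCircle.coe_nsmul, nsmul_eq_mul,
      mul_div_cancel₀ _ (Nat.cast_ne_zero.mpr (NeZero.ne N))]
    exact_mod_cast coe_int_QmodZ n
  have h2 : ∀ j : ℕ, a n * e ((n : ℂ) * (((j : ℝ) +ᵥ τ : ℍ) : ℂ) / N) * eQ (-(j • x)) =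
      a n * e ((n : ℂ) * τ / N) * eQ (j • (y - x)) := fun j => by
    have h3 : eQ (j • y) = e ((j : ℂ) * ((n : ℂ) / N)) := by
      rw [eQ_nsmul, hy, eQ_coe, e_nat_mul]
      push_cast
      rfl
    rw [nsmul_sub, sub_eq_add_neg, eQ_add, h3, UpperHalfPlane.coe_vadd,
      show (n : ℂ) * (((j : ℝ) : ℂ) + τ) / N = (n : ℂ) * τ / N + (j : ℂ) * ((n : ℂ) / N) by
        push_cast; ring, e_add]
    ring
  simp_rw [h2]
  rw [← Finset.mul_sum, Fin.sum_univ_eq_sum_range (fun j => eQ (j • (y - x))),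
    sum_range_eQ_nsmul hNy]
  simp only [sub_eq_zero]
  split_ifs <;> ring

theorem HasExpansion.vadd_eq (τ : ℍ) : g ((N : ℝ) +ᵥ τ) = g τ := by
  refine (hg _).unique ?_
  convert hg τ using 2 with n
  have hN : (N : ℂ) ≠ 0 := Nat.cast_ne_zero.mpr (NeZero.ne N)
  rw [UpperHalfPlane.coe_vadd,
    show (n : ℂ) * (((N : ℝ) : ℂ) + τ) / N = (n : ℂ) * τ / N + ((n : ℤ) : ℂ) by
      push_cast; field_simp; ring, e_add_int]

theorem HasExpansion.hasRatExpansion_expansionPart (x : QmodZ)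
    [DecidablePred fun y : QmodZ => y = x] :
    HasRatExpansion (fun m => if (m : QmodZ) = x then
      Function.extend (fun n : ℕ => (n : ℚ) / N) a 0 m else 0) (expansionPart N a x) := by
  have hN : (N : ℚ) ≠ 0 := Nat.cast_ne_zero.mpr (NeZero.ne N)
  have hinj : Function.Injective (fun n : ℕ => (n : ℚ) / N) := fun m n h => by
    simpa [div_left_inj' hN] using h
  have h := hasRatExpansion_extend (b := fun n => if (((n : ℚ) / N : ℚ) : QmodZ) = x then a n else 0)
    (h := expansionPart N a x) hinj fun τ => by
      convert hg.hasSum_expansionPart x τ using 2 with n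
      rw [ite_mul, zero_mul]
      push_cast
      rw [div_mul_eq_mul_div]
  convert h using 1
  funext m
  by_cases hm : ∃ n : ℕ, (n : ℚ) / N = m
  · obtain ⟨n, rfl⟩ := hm
    rw [hinj.extend_apply a 0 n, hinj.extend_apply _ 0 n]
  · rw [Function.extend_apply' _ _ _ hm, Function.extend_apply' _ _ _ hm]
    simp

end Parts

theorem HasRatExpansion.const_mul {c : ℚ → ℂ} {h : ℍ → ℂ} (hc : HasRatExpansion c h) (u : ℂ) :
    HasRatExpansion (fun m => u * c m) (fun τ => u * h τ) := fun τ => by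
  simpa [mul_assoc] using (hc τ).mul_left u

theorem HasRatExpansion.add {c c' : ℚ → ℂ} {h h' : ℍ → ℂ} (hc : HasRatExpansion c h)
    (hc' : HasRatExpansion c' h') :
    HasRatExpansion (fun m => c m + c' m) (fun τ => h τ + h' τ) := fun τ => by
  simpa [add_mul] using (hc τ).add (hc' τ)

/-! ### Slash operators of some matrices -/

theorem slash_T_pow_apply (f : ℍ → ℂ) (k : ℤ) (j : ℕ) (τ : ℍ) :
    (f ∣[k] (T ^ j : SL(2, ℤ))) τ = f ((j : ℝ) +ᵥ τ) := by
  have h : (T ^ j : SL(2, ℤ)) • τ = (j : ℝ) +ᵥ τ := by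
    have := UpperHalfPlane.modular_T_zpow_smul τ (j : ℤ)
    rw [zpow_natCast] at this
    rw [this]
    simp
  rw [ModularForm.SL_slash_apply, h, ModularGroup.denom_apply, ← zpow_natCast, coe_T_zpow]
  simp

theorem slash_S_sq (f : ℍ → ℂ) (k : ℤ) : f ∣[k] (S ^ 2 : SL(2, ℤ)) = ((-1 : ℂ) ^ k) • f := by
  ext τ
  have h : (-1 : SL(2, ℤ)) • τ = τ := by simp
  rw [S_sq, ModularForm.SL_slash_apply, h, ModularGroup.denom_apply]
  simp [mul_comm, ← inv_zpow]

namespace EvenLattice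

variable {V : Type*} [AddCommGroup V] [Module ℚ V] {L : EvenLattice V}

/-! ### General properties of lifts -/

section General

variable {ρ : Representation ℂ SL(2, ℤ) (L.Disc → ℂ)} {N : ℕ} {k : ℤ} {f : ℍ → ℂ} {γ : L.Disc}

/-- Taken with `γ' = γ` this is invariance under a generator of `Γ₁(N)`; taken with `A = S²` and `γ'
= -γ` it moves the central sign from the matrix to `γ`. -/
theorem liftTerm_mul_of_slash_eq {A : SL(2, ℤ)} {u w : ℂ} {γ' : L.Disc}
    (hf : f ∣[k] A = u • f) (hρ : ρ A⁻¹ (L.basisVec γ) = w • L.basisVec γ') (huw : u * w = 1)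
    (M : SL(2, ℤ)) (τ : ℍ) :
    L.liftTerm ρ k f γ (A * M) τ = L.liftTerm ρ k f γ' M τ := by
  rw [liftTerm, liftTerm, SlashAction.slash_mul, hf, ModularForm.SL_smul_slash, mul_inv_rev, map_mul,
    Module.End.mul_apply, hρ, map_smul, smul_smul, Pi.smul_apply, smul_eq_mul, mul_right_comm, huw,
    one_mul]

/-- The matrices that leave all summands unchanged form a subgroup, so generators of `Γ₁(N)`
suffice. -/
theorem liftIsWellDefined_of_le (hN : N = 2 ∨ N = 3)
    (hT : ∀ M τ, L.liftTerm ρ k f γ (T * M) τ = L.liftTerm ρ k f γ M τ)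
    (hV : ∀ M τ, L.liftTerm ρ k f γ (S * T ^ N * S⁻¹ * M) τ = L.liftTerm ρ k f γ M τ)
    (hS : N = 2 → ∀ M τ, L.liftTerm ρ k f γ (S ^ 2 * M) τ = L.liftTerm ρ k f γ M τ) :
    L.LiftIsWellDefined ρ N k f γ := by
  let H : Subgroup SL(2, ℤ) :=
    { carrier := {A | ∀ M τ, L.liftTerm ρ k f γ (A * M) τ = L.liftTerm ρ k f γ M τ}
      one_mem' := fun M τ => by rw [one_mul]
      mul_mem' := fun {A B} hA hB M τ => by rw [mul_assoc, hA, hB]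
      inv_mem' := fun {A} hA M τ => by rw [← hA, mul_inv_cancel_left] }
  exact fun A hA => Gamma1_le (H := H) hN hT hV hS hA

/-- The cocycle property of the slash operator, together with `ρ(M) ρ((AM)⁻¹) = ρ(A⁻¹)`. -/
theorem liftTerm_smul (A M : SL(2, ℤ)) (τ : ℍ) :
    L.liftTerm ρ k f γ A (M • τ) =
      ((M 1 0 : ℂ) * (τ : ℂ) + (M 1 1 : ℂ)) ^ k • ρ M (L.liftTerm ρ k f γ (A * M) τ) := by
  have h1 : ((M 1 0 : ℂ) * (τ : ℂ) + (M 1 1 : ℂ)) ≠ 0 := by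
    have := UpperHalfPlane.denom_ne_zero (M : GL (Fin 2) ℝ) τ
    rwa [ModularGroup.denom_apply] at this
  have h2 : (f ∣[k] (A * M)) τ =
      (f ∣[k] A) (M • τ) * ((M 1 0 : ℂ) * (τ : ℂ) + (M 1 1 : ℂ)) ^ (-k) := by
    rw [SlashAction.slash_mul, ModularForm.SL_slash_apply, ModularGroup.denom_apply]
  rw [liftTerm, liftTerm, map_smul, smul_smul, h2, mul_left_comm, ← zpow_add₀ h1, add_neg_cancel,
    zpow_zero, mul_one, mul_inv_rev, map_mul, ← Module.End.mul_apply, ← mul_assoc, ← map_mul,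
    mul_inv_cancel, map_one, one_mul]

theorem liftTerm_apply (M : SL(2, ℤ)) (τ : ℍ) (δ : L.Disc) :
    L.liftTerm ρ k f γ M τ δ = (f ∣[k] M) τ * ρ M⁻¹ (L.basisVec γ) δ := rfl

section WellDefined

variable (hw : L.LiftIsWellDefined ρ N k f γ)
include hw

theorem LiftIsWellDefined.liftTerm_eq_of_rightRel {M M' : SL(2, ℤ)}
    (h : (QuotientGroup.rightRel (Gamma1 N)) M M') (τ : ℍ) :
    L.liftTerm ρ k f γ M τ = L.liftTerm ρ k f γ M' τ := by
  rw [QuotientGroup.rightRel_apply] at h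
  rw [← hw _ h M τ, inv_mul_cancel_right]

theorem LiftIsWellDefined.liftTerm_out (M : SL(2, ℤ)) (τ : ℍ) :
    L.liftTerm ρ k f γ (Quotient.out (⟦M⟧ : Quotient (QuotientGroup.rightRel (Gamma1 N)))) τ =
      L.liftTerm ρ k f γ M τ :=
  hw.liftTerm_eq_of_rightRel (Quotient.mk_out M) τ

theorem LiftIsWellDefined.lift_eq_sum (hN : N = 2 ∨ N = 3) (τ : ℍ) :
    L.lift ρ N k f γ τ = ∑ x, L.liftTerm ρ k f γ (cosetRep N x) τ := by
  rw [lift, ← finsum_eq_sum_of_fintype]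
  exact (finsum_eq_of_bijective _ (bijective_mk_cosetRep hN) fun x => (hw.liftTerm_out _ τ).symm).symm

/-- By `liftTerm_smul` the action of `M` replaces each coset by its right translate, and right
translation permutes the cosets. -/
theorem LiftIsWellDefined.lift_smul [NeZero N] (M : SL(2, ℤ)) (τ : ℍ) :
    L.lift ρ N k f γ (M • τ) =
      ((M 1 0 : ℂ) * (τ : ℂ) + (M 1 1 : ℂ)) ^ k • ρ M (L.lift ρ N k f γ τ) := by
  have hrel : ∀ B A A' : SL(2, ℤ), (QuotientGroup.rightRel (Gamma1 N)) A A' →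
      (QuotientGroup.rightRel (Gamma1 N)) (A * B) (A' * B) := fun B A A' h => by
    rw [QuotientGroup.rightRel_apply] at h ⊢
    rwa [mul_inv_rev, ← mul_assoc, mul_inv_cancel_right]
  let E : Quotient (QuotientGroup.rightRel (Gamma1 N)) ≃
      Quotient (QuotientGroup.rightRel (Gamma1 N)) :=
    { toFun := Quotient.map (· * M) (hrel M)
      invFun := Quotient.map (· * M⁻¹) (hrel M⁻¹)
      left_inv := fun x => by
        induction x using Quotient.inductionOn with | h A => simp
      right_inv := fun x => by
        induction x using Quotient.inductionOn with | h A => simp }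
  have hE : ∀ x, L.liftTerm ρ k f γ (Quotient.out (E x)) τ =
      L.liftTerm ρ k f γ (Quotient.out x * M) τ := fun x => by
    have : E x = ⟦Quotient.out x * M⟧ := by
      conv_lhs => rw [← Quotient.out_eq x]
      rfl
    rw [this, hw.liftTerm_out]
  have : Finite (Quotient (QuotientGroup.rightRel (Gamma1 N))) :=
    Finite.of_equiv _ (QuotientGroup.quotientRightRelEquivQuotientLeftRel (Gamma1 N)).symm
  have := Fintype.ofFinite (Quotient (QuotientGroup.rightRel (Gamma1 N)))
  have hR : L.lift ρ N k f γ τ = ∑ᶠ x : Quotient (QuotientGroup.rightRel (Gamma1 N)),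
      L.liftTerm ρ k f γ (Quotient.out x * M) τ := by
    rw [lift, ← finsum_comp_equiv E]
    exact finsum_congr hE
  rw [hR, lift, finsum_eq_sum_of_fintype, finsum_eq_sum_of_fintype, map_sum, Finset.smul_sum]
  exact Finset.sum_congr rfl fun x _ => liftTerm_smul _ _ _

theorem LiftIsWellDefined.mdifferentiable_lift (hN : N = 2 ∨ N = 3)
    (hf : MDifferentiable 𝓘(ℂ) 𝓘(ℂ) f) (δ : L.Disc) :
    MDifferentiable 𝓘(ℂ) 𝓘(ℂ) (fun τ : ℍ => L.lift ρ N k f γ τ δ) := by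
  have h : (fun τ : ℍ => L.lift ρ N k f γ τ δ) = ∑ x, (f ∣[k] cosetRep N x) *
      fun _ : ℍ => ρ (cosetRep N x)⁻¹ (L.basisVec γ) δ := by
    ext τ
    rw [hw.lift_eq_sum hN, Finset.sum_apply, Finset.sum_apply]
    rfl
  rw [h]
  exact MDifferentiable.sum fun x _ => (hf.slash k _).mul mdifferentiable_const

end WellDefined

end General

/-! ### Uniqueness of forms with given principal part -/

theorem IsWeaklyHolomorphicForm.eq_of_principalPart [Finite L.Disc]
    {ρ : Representation ℂ SL(2, ℤ) (L.Disc → ℂ)} {k : ℤ} (hk : k < 0) {N : ℕ} [NeZero N]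
    (hρ : ∀ M ∈ Gamma N, ρ M = 1) {F G : ℍ → L.Disc → ℂ}
    (hF : L.IsWeaklyHolomorphicForm ρ k F) (hG : L.IsWeaklyHolomorphicForm ρ k G)
    {P : L.Disc → ℚ → ℂ} (hFP : L.HasPrincipalPart F P) (hGP : L.HasPrincipalPart G P) :
    F = G := by
  classical
  have := Fintype.ofFinite L.Disc
  obtain ⟨c, hc, hcP⟩ := hFP
  obtain ⟨c', hc', hcP'⟩ := hGP
  have hslash : ∀ (M : SL(2, ℤ)) (δ : L.Disc),
      ((fun τ => F τ δ - G τ δ) ∣[k] M) = fun τ => ρ M (F τ - G τ) δ := fun M δ => by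
    ext τ
    have h1 : ((M 1 0 : ℂ) * (τ : ℂ) + (M 1 1 : ℂ)) ≠ 0 := by
      have := UpperHalfPlane.denom_ne_zero (M : GL (Fin 2) ℝ) τ
      rwa [ModularGroup.denom_apply] at this
    rw [ModularForm.SL_slash_apply, ModularGroup.denom_apply, hF.transform, hG.transform, map_sub,
      Pi.smul_apply, Pi.smul_apply, smul_eq_mul, smul_eq_mul, Pi.sub_apply, ← mul_sub,
      mul_right_comm, ← zpow_add₀ h1, add_neg_cancel, zpow_zero, one_mul]
  have hexp : ∀ δ, HasRatExpansion (fun m => c δ m - c' δ m) (fun τ => F τ δ - G τ δ) :=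
    fun δ τ => by simpa [sub_mul] using (hc.2.2 δ τ).sub (hc'.2.2 δ τ)
  have hbdd : ∀ δ, UpperHalfPlane.IsBoundedAtImInfty (fun τ => F τ δ - G τ δ) := fun δ =>
    (hexp δ).isBoundedAtImInfty fun m hm => by rw [hcP δ m hm, hcP' δ m hm, sub_self]
  -- Slashing a component by `M` gives a fixed linear combination of all components, with
  -- coefficients from `ρ(M)`. Boundedness at `∞` therefore gives boundedness at every cusp.
  have hbddM : ∀ (M : SL(2, ℤ)) (δ : L.Disc),
      UpperHalfPlane.IsBoundedAtImInfty ((fun τ => F τ δ - G τ δ) ∣[k] M) := fun M δ => by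
    have h1 : ((fun τ => F τ δ - G τ δ) ∣[k] M) =
        ∑ γ, fun τ => ρ M (L.basisVec γ) δ * (F τ γ - G τ γ) := by
      rw [hslash]
      ext τ
      have h2 : F τ - G τ = ∑ γ, (F τ γ - G τ γ) • L.basisVec γ := by
        ext γ'
        simp [basisVec_apply, Finset.sum_apply]
      rw [h2, map_sum]
      simp [Finset.sum_apply, mul_comm]
    rw [h1]
    refine Finset.sum_induction _ UpperHalfPlane.IsBoundedAtImInfty (fun _ _ ha hb => ha.add hb)
      (Filter.zero_zeroAtFilter _).boundedAtFilter fun γ _ => ?_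
    exact (Filter.const_boundedAtFilter _ _).mul (hbdd γ)
  ext τ δ
  -- Since `ρ` is trivial on `Γ(N)`, each component is a scalar form for `Γ(N)`, and its weight is
  -- negative.
  let h : ModularForm ((Gamma N : Subgroup SL(2, ℤ)) : Subgroup (GL (Fin 2) ℝ)) k :=
    { toFun := fun τ => F τ δ - G τ δ
      slash_action_eq' := by
        rintro _ ⟨M, hM, rfl⟩
        change ((fun τ => F τ δ - G τ δ) ∣[k] M) = _
        rw [hslash, hρ M hM]
        rfl
      holo' := (hF.holomorphic δ).sub (hG.holomorphic δ)
      bdd_at_cusps' := fun {x} hx => by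
        rw [Subgroup.IsArithmetic.isCusp_iff_isCusp_SL2Z] at hx
        rw [OnePoint.isBoundedAt_iff_forall_SL2Z hx]
        exact fun M _ => hbddM M δ }
  have h0 := ModularForm.isZero_of_neg_weight hk h
  have h1 : h τ = 0 := by rw [h0]; rfl
  exact sub_eq_zero.mp h1

end EvenLattice

/-! ### Lifts of functions with a simple pole at `∞` and none at `0` -/

/-- `f` is holomorphic on `ℍ`, `f = e(-τ/N) + O(1)` with exponents in `-1/N + ℤ`, and
`f|_k S = a(0) + O(e(τ/N))` with exponents in `ℤ/N`. -/
structure IsLiftable (N : ℕ) (k : ℤ) (f : ℍ → ℂ) (b a : ℕ → ℂ) : Prop where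
  holomorphic : MDifferentiable 𝓘(ℂ) 𝓘(ℂ) f
  hasSum : ∀ τ : ℍ, HasSum (fun n : ℕ => b n * e (((n - 1 / N : ℚ) : ℂ) * τ)) (f τ)
  leading : b 0 = 1
  hasExpansion : HasExpansion N a (f ∣[k] S)

namespace IsLiftable

variable {N : ℕ} {k : ℤ} {f : ℍ → ℂ} {b a : ℕ → ℂ} (hf : IsLiftable N k f b a)
include hf

theorem slash_T : f ∣[k] T = e (-1 / N) • f := by
  ext τ
  have h := slash_T_pow_apply f k 1 τ
  rw [pow_one] at h
  rw [h, Pi.smul_apply, smul_eq_mul]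
  have h1 : (fun n : ℕ => b n * e (((n - 1 / N : ℚ) : ℂ) * ((((1 : ℕ) : ℝ) +ᵥ τ : ℍ) : ℂ))) =
      fun n => e (-1 / N) * (b n * e (((n - 1 / N : ℚ) : ℂ) * τ)) := by
    funext n
    rw [mul_left_comm, ← e_add, UpperHalfPlane.coe_vadd,
      show ((n - 1 / N : ℚ) : ℂ) * (((((1 : ℕ) : ℝ)) : ℂ) + (τ : ℂ)) =
        (-1 / N + ((n - 1 / N : ℚ) : ℂ) * τ) + ((n : ℤ) : ℂ) by push_cast; ring, e_add_int]
  refine (hf.hasSum _).unique ?_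
  rw [h1]
  exact (hf.hasSum τ).mul_left _

theorem slash_S_T_pow_S_inv [NeZero N] : f ∣[k] (S * T ^ N * S⁻¹) = f := by
  have h : (f ∣[k] S) ∣[k] (T ^ N : SL(2, ℤ)) = f ∣[k] S := by
    ext τ
    rw [slash_T_pow_apply, hf.hasExpansion.vadd_eq]
  rw [SlashAction.slash_mul, SlashAction.slash_mul, h, ← SlashAction.slash_mul, mul_inv_cancel,
    SlashAction.slash_one]

theorem hasRatExpansion : HasRatExpansion (Function.extend (fun n : ℕ => (n - 1 / N : ℚ)) b 0) f :=
  hasRatExpansion_extend (fun m n h => by simpa using h) hf.hasSum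

end IsLiftable

namespace EvenLattice

variable {V : Type*} [AddCommGroup V] [Module ℚ V] {L : EvenLattice V}

section Formulas

variable {N : ℕ} {k : ℤ} (hL : L.IsNiceOfLevel N) (hk : L.sigDiff = 2 * k)
  {ρ : Representation ℂ SL(2, ℤ) (L.Disc → ℂ)} (hρ : L.IsWeilRepresentation ρ)

include hL hk hρ in
theorem IsWeilRepresentation.apply_S_sq (γ : L.Disc) :
    ρ (S ^ 2) (L.basisVec γ) = (-1 : ℂ) ^ k • L.basisVec (-γ) := by
  classical
  have := hL.finite
  have := Fintype.ofFinite L.Disc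
  rw [isWeilRepresentation_iff] at hρ
  ext δ
  rw [map_pow, hρ.1, hL.weilS_sq_apply hk, Pi.smul_apply, smul_eq_mul, basisVec_apply,
    basisVec_apply]
  simp only [neg_eq_iff_eq_neg]

theorem neg_one_zpow_mul_self (k : ℤ) : (-1 : ℂ) ^ k * (-1 : ℂ) ^ k = 1 := by
  rw [← mul_zpow]; simp

include hL hk hρ in
theorem IsWeilRepresentation.apply_S_sq_inv (γ : L.Disc) :
    ρ (S ^ 2)⁻¹ (L.basisVec γ) = (-1 : ℂ) ^ k • L.basisVec (-γ) := by
  have h : (S ^ 2 : SL(2, ℤ))⁻¹ = S ^ 2 := by rw [S_sq]; exact inv_neg_one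
  rw [h, hρ.apply_S_sq hL hk]

include hL hk hρ in
-- `S⁻¹ = S · S⁻²`, and `S⁻²` replaces `γ` by `-γ` up to `(-1)^k`; this flips the sign in the
-- exponential.
theorem IsWeilRepresentation.apply_S_inv (γ δ : L.Disc) :
    ρ S⁻¹ (L.basisVec γ) δ = (-1 : ℂ) ^ k * L.weilConst * eQ (L.pairing δ γ) := by
  have h : (S : SL(2, ℤ))⁻¹ = S * (S ^ 2)⁻¹ := by group
  rw [h, map_mul, Module.End.mul_apply, hρ.apply_S_sq_inv hL hk, map_smul, Pi.smul_apply, smul_eq_mul,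
    hρ.2, weilConst, pairing_comm, pairing_neg_left, neg_neg, pairing_comm]
  ring

include hL hρ in
theorem IsWeilRepresentation.apply_T_pow_inv (j : ℕ) (v : L.Disc → ℂ) (δ : L.Disc) :
    ρ (T ^ j)⁻¹ v δ = eQ (-(j • L.Q δ)) * v δ := by
  have := hL.finite
  have := Fintype.ofFinite L.Disc
  rw [isWeilRepresentation_iff] at hρ
  have h : ∀ (j : ℕ) (w : L.Disc → ℂ), ρ (T ^ j) w δ = eQ (j • L.Q δ) * w δ := fun j => by
    induction j with
    | zero => simp
    | succ j ih =>
      intro w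
      rw [pow_succ, map_mul, Module.End.mul_apply, ih, hρ.2, weilT_apply, succ_nsmul, eQ_add]
      ring
  have h1 := h j (ρ (T ^ j)⁻¹ v)
  rw [← Module.End.mul_apply, ← map_mul, mul_inv_cancel, map_one, Module.End.one_apply] at h1
  rw [h1, ← mul_assoc, eQ_neg_mul_self, one_mul]

end Formulas

section Lift

variable {N : ℕ} (hN : N = 2 ∨ N = 3) {k : ℤ} (hL : L.IsNiceOfLevel N) (hk : L.sigDiff = 2 * k)
  (hev : N = 2 → Even k)
  {ρ : Representation ℂ SL(2, ℤ) (L.Disc → ℂ)} (hρ : L.IsWeilRepresentation ρ)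
  {γ : L.Disc} (hγ : L.Q γ = ((-1 / N : ℚ) : QmodZ))
  {f : ℍ → ℂ} {b a : ℕ → ℂ} (hf : IsLiftable N k f b a)

include hN hL hk hev in
theorem IsNiceOfLevel.existsUnique_of_eq_two_or_three :
    ∃! ρ : Representation ℂ SL(2, ℤ) (L.Disc → ℂ), L.IsWeilRepresentation ρ := by
  rcases hN with rfl | rfl
  · have : Fact (1 < 2) := ⟨by norm_num⟩
    exact hL.existsUnique_isWeilRepresentation hk (by decide) fun _ => hev rfl
  · have : Fact (1 < 3) := ⟨by norm_num⟩
    exact hL.existsUnique_isWeilRepresentation hk (by decide) fun h => absurd h (by decide)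

include hN hL hk hev hρ in
theorem IsWeilRepresentation.eq_one_of_mem_Gamma {M : SL(2, ℤ)} (hM : M ∈ Gamma N) : ρ M = 1 := by
  rcases hN with rfl | rfl
  · have : Fact (1 < 2) := ⟨by norm_num⟩
    exact hL.apply_eq_one_of_mem_Gamma hk (by decide) (fun _ => hev rfl) hρ hM
  · have : Fact (1 < 3) := ⟨by norm_num⟩
    exact hL.apply_eq_one_of_mem_Gamma hk (by decide) (fun h => absurd h (by decide)) hρ hM

include hN hL hk hev hρ hγ hf

/-- For `T` the factor `e(-1/N)` of `f` cancels against `e(-Q(γ))`. The matrix `S T^N S⁻¹` fixes `f`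
and lies in `Γ(N)`. For `N = 2` the two signs `(-1)^k` of `S²` cancel and `-γ = γ`. -/
theorem liftIsWellDefined : L.LiftIsWellDefined ρ N k f γ := by
  have : NeZero N := ⟨by rcases hN with rfl | rfl <;> norm_num⟩
  refine liftIsWellDefined_of_le hN (liftTerm_mul_of_slash_eq (u := e (-1 / N))
    (w := eQ (-L.Q γ)) hf.slash_T ?_ ?_) (liftTerm_mul_of_slash_eq (u := 1) (w := 1) ?_ ?_ (by simp))
    fun h2 => liftTerm_mul_of_slash_eq (slash_S_sq f k) (w := (-1 : ℂ) ^ k) ?_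
      (neg_one_zpow_mul_self k)
  · classical
    ext δ
    have h := hρ.apply_T_pow_inv hL 1 (L.basisVec γ) δ
    rw [pow_one, one_smul] at h
    rw [h, Pi.smul_apply, smul_eq_mul, basisVec_apply]
    split_ifs with h'
    · rw [h']
    · simp
  · rw [hγ, eQ_neg, eQ_coe]
    push_cast
    exact mul_inv_cancel₀ (e_ne_zero _)
  · rw [hf.slash_S_T_pow_S_inv, one_smul]
  · have hV : (S * T ^ N * S⁻¹)⁻¹ ∈ Gamma N := by
      refine inv_mem ?_
      have := coe_S_mul_T_zpow_mul_S_inv (N : ℤ)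
      rw [zpow_natCast] at this
      rw [Gamma_mem, this]
      simp
    rw [hρ.eq_one_of_mem_Gamma hN hL hk hev hV, one_smul, Module.End.one_apply]
  · have h3 : -γ = γ := by
      have := hL.nsmul_eq_zero γ
      rw [h2, two_nsmul] at this
      exact neg_eq_of_add_eq_zero_left this
    rw [hρ.apply_S_sq_inv hL hk, h3]

theorem lift_apply (τ : ℍ) (δ : L.Disc) :
    L.lift ρ N k f γ τ δ =
      f τ * ∑ i : Fin (N - 1), L.basisVec ((-1 : ℤ) ^ (i : ℕ) • γ) δ +
      ((-1 : ℂ) ^ k * L.weilConst * N *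
        ∑ i : Fin (N - 1), eQ (L.pairing δ ((-1 : ℤ) ^ (i : ℕ) • γ))) *
      expansionPart N a (L.Q δ) τ := by
  have : NeZero N := ⟨by rcases hN with rfl | rfl <;> norm_num⟩
  -- The powers of `S²` in the coset representatives only change `γ` to `(-1)^i γ`.
  have hpow : ∀ (i : ℕ) (γ : L.Disc) (M : SL(2, ℤ)),
      L.liftTerm ρ k f γ ((S ^ 2) ^ i * M) τ = L.liftTerm ρ k f ((-1 : ℤ) ^ i • γ) M τ := fun i => by
    induction i with
    | zero => simp
    | succ i ih =>
      intro γ M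
      rw [pow_succ', mul_assoc, liftTerm_mul_of_slash_eq (slash_S_sq f k)
        (hρ.apply_S_sq_inv hL hk γ) (neg_one_zpow_mul_self k), ih, pow_succ, mul_smul]
      simp
  have hS : ∀ (γ : L.Disc) (j : ℕ), L.liftTerm ρ k f γ (S * T ^ j) τ δ =
      (-1 : ℂ) ^ k * L.weilConst * eQ (L.pairing δ γ) *
        ((f ∣[k] S) ((j : ℝ) +ᵥ τ) * eQ (-(j • L.Q δ))) := fun γ j => by
    rw [liftTerm_apply, SlashAction.slash_mul, slash_T_pow_apply, mul_inv_rev, map_mul,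
      Module.End.mul_apply, hρ.apply_T_pow_inv hL, hρ.apply_S_inv hL hk]
    ring
  rw [(liftIsWellDefined hN hL hk hev hρ hγ hf).lift_eq_sum hN, Finset.sum_apply,
    Fintype.sum_prod_type, Finset.mul_sum, Finset.mul_sum, Finset.sum_mul, ← Finset.sum_add_distrib]
  refine Finset.sum_congr rfl fun i _ => ?_
  rw [Fintype.sum_option]
  simp only [cosetRep, hpow, hS]
  -- The `N` terms `S T^j` combine into `N` times the part of `f|S` with exponents in `Q(δ) + ℤ`.
  rw [← Finset.mul_sum, hf.hasExpansion.sum_translates _ (hL.nsmul_Q δ)]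
  have h1 := hpow i γ 1
  rw [mul_one] at h1
  rw [h1, liftTerm_apply, SlashAction.slash_one, inv_one, map_one, Module.End.one_apply]
  ring

open scoped Classical in
/-- The Fourier coefficients of the lift. -/
theorem isFourierExpansion_lift :
    L.IsFourierExpansion (L.lift ρ N k f γ) (fun δ m =>
      (∑ i : Fin (N - 1), L.basisVec ((-1 : ℤ) ^ (i : ℕ) • γ) δ) *
        Function.extend (fun n : ℕ => (n - 1 / N : ℚ)) b 0 m +
      ((-1 : ℂ) ^ k * L.weilConst * N *
        ∑ i : Fin (N - 1), eQ (L.pairing δ ((-1 : ℤ) ^ (i : ℕ) • γ))) *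
      (if (m : QmodZ) = L.Q δ then Function.extend (fun n : ℕ => (n : ℚ) / N) a 0 m else 0)) := by
  have : NeZero N := ⟨by rcases hN with rfl | rfl <;> norm_num⟩
  -- The lower bound `-1` suffices because the smallest exponent is `-1/N`. If `m` is not in `Q(δ) +
  -- ℤ`, only the contribution of `f` can be nonzero; it lives on `±γ`, where `Q = -1/N`, so its
  -- exponents lie in the right class after all.
  refine ⟨fun δ m hm => ?_, ⟨-1, fun δ m hm => ?_⟩, fun δ τ => ?_⟩
  · by_contra hne
    dsimp only at hm
    rw [if_neg hne, mul_zero, add_zero] at hm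
    have h1 := left_ne_zero_of_mul hm
    have h2 := right_ne_zero_of_mul hm
    obtain ⟨i, -, hi⟩ := Finset.exists_ne_zero_of_sum_ne_zero h1
    rw [basisVec_apply, ite_ne_right_iff] at hi
    have hδ : L.Q δ = ((-1 / N : ℚ) : QmodZ) := by
      rw [hi.1, ← hγ]
      rcases neg_one_pow_eq_or ℤ (i : ℕ) with h | h <;> simp [h]
    obtain ⟨n, rfl⟩ : ∃ n : ℕ, (n - 1 / N : ℚ) = m := by
      by_contra h
      exact h2 (Function.extend_apply' _ _ _ h)
    refine hne ?_
    rw [hδ, show (n - 1 / N : ℚ) = ((n : ℤ) : ℚ) + -1 / N by push_cast; ring, AddCircle.coe_add,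
      coe_int_QmodZ, zero_add]
  · have hN1 : (1 : ℚ) ≤ N := by
      exact_mod_cast NeZero.one_le
    have hN2 : (1 / N : ℚ) ≤ 1 := by
      rw [div_le_one (by linarith)]; exact hN1
    dsimp only
    rw [Function.extend_apply', Function.extend_apply']
    · simp
    · rintro ⟨n, rfl⟩
      have : (0 : ℚ) ≤ n / N := by positivity
      linarith
    · rintro ⟨n, rfl⟩
      have : (0 : ℚ) ≤ n := by positivity
      linarith
  · rw [lift_apply hN hL hk hev hρ hγ hf, mul_comm (f τ)]
    exact ((hf.hasRatExpansion.const_mul _).add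
      ((hf.hasExpansion.hasRatExpansion_expansionPart (L.Q δ)).const_mul _)) τ

/-- The part coming from `f|S` has no negative exponents, and among the exponents `n - 1/N` of `f`
only `n = 0` is negative. -/
theorem hasPrincipalPart_lift :
    L.HasPrincipalPart (L.lift ρ N k f γ) (fun δ m =>
      if m = -1 / N then ∑ i : Fin (N - 1), L.basisVec ((-1 : ℤ) ^ (i : ℕ) • γ) δ else 0) := by
  have : NeZero N := ⟨by rcases hN with rfl | rfl <;> norm_num⟩
  have hinj : Function.Injective (fun n : ℕ => (n - 1 / N : ℚ)) := fun m n h => by simpa using h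
  have hN1 : (1 : ℚ) ≤ N := by
    exact_mod_cast NeZero.one_le
  have hN2 : (1 / N : ℚ) ≤ 1 := by
    rw [div_le_one (by linarith)]; exact hN1
  refine ⟨_, isFourierExpansion_lift hN hL hk hev hρ hγ hf, fun δ m hm => ?_⟩
  rw [Function.extend_apply' (f := fun n : ℕ => (n : ℚ) / N)]
  · simp only [Pi.zero_apply, ite_self, mul_zero, add_zero]
    split_ifs with h
    · have h1 := hinj.extend_apply b 0 0
      rw [hf.leading] at h1
      have h2 : (((0 : ℕ) : ℚ) - 1 / N : ℚ) = m := by rw [h]; push_cast; ring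
      rw [h2] at h1
      rw [h1, mul_one]
    · rw [Function.extend_apply']
      · simp
      · rintro ⟨n, rfl⟩
        rcases Nat.eq_zero_or_pos n with rfl | hn
        · exact h (by push_cast; ring)
        · have : (1 : ℚ) ≤ n := by exact_mod_cast hn
          linarith
  · rintro ⟨n, rfl⟩
    have : (0 : ℚ) ≤ n / N := by positivity
    linarith

theorem constantCoeff_lift :
    ∃ c, L.IsFourierExpansion (L.lift ρ N k f γ) c ∧
      c 0 0 = (-1 : ℂ) ^ k * L.weilConst * N * (N - 1 : ℕ) * a 0 := by
  have : NeZero N := ⟨by rcases hN with rfl | rfl <;> norm_num⟩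
  have hN0 : (N : ℚ) ≠ 0 := Nat.cast_ne_zero.mpr (NeZero.ne N)
  have hinj : Function.Injective (fun n : ℕ => (n : ℚ) / N) := fun m n h => by
    simpa [div_left_inj' hN0] using h
  refine ⟨_, isFourierExpansion_lift hN hL hk hev hρ hγ hf, ?_⟩
  have h1 := hinj.extend_apply a 0 0
  simp only [Nat.cast_zero, zero_div] at h1
  rw [Function.extend_apply' (f := fun n : ℕ => (n - 1 / N : ℚ)), h1]
  · simp [mul_assoc]
  -- The exponents `n - 1/N` of `f` are never `0`, as `N > 1`; so the constant term comes from `a 0`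
  -- alone.
  · rintro ⟨n, hn⟩
    have h2 : ((n * N : ℕ) : ℚ) = 1 := by
      push_cast
      field_simp at hn
      linarith
    have h3 : n * N = 1 := by exact_mod_cast h2
    rcases hN with rfl | rfl <;> omega

theorem isWeaklyHolomorphicForm_lift : L.IsWeaklyHolomorphicForm ρ k (L.lift ρ N k f γ) := by
  have : NeZero N := ⟨by rcases hN with rfl | rfl <;> norm_num⟩
  have hw := liftIsWellDefined hN hL hk hev hρ hγ hf
  exact ⟨hw.mdifferentiable_lift hN hf.holomorphic, hw.lift_smul,
    _, isFourierExpansion_lift hN hL hk hev hρ hγ hf⟩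

theorem isWeaklyHolomorphicForm_and_hasPrincipalPart_iff (hk0 : k < 0) (G : ℍ → L.Disc → ℂ) :
    (L.IsWeaklyHolomorphicForm ρ k G ∧ L.HasPrincipalPart G (fun δ m =>
      if m = -1 / N then ∑ i : Fin (N - 1), L.basisVec ((-1 : ℤ) ^ (i : ℕ) • γ) δ else 0)) ↔
    G = L.lift ρ N k f γ := by
  have : NeZero N := ⟨by rcases hN with rfl | rfl <;> norm_num⟩
  have := hL.finite
  have h1 := isWeaklyHolomorphicForm_lift hN hL hk hev hρ hγ hf
  have h2 := hasPrincipalPart_lift hN hL hk hev hρ hγ hf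
  constructor
  · rintro ⟨h3, h4⟩
    exact h3.eq_of_principalPart hk0
      (fun M hM => hρ.eq_one_of_mem_Gamma hN hL hk hev hM) h1 h4 h2
  · rintro rfl
    exact ⟨h1, h2⟩

end Lift

end EvenLattice

/-! ### Eta quotients -/

/-- Euler's product `∏ (1 - qⁿ)`. -/
noncomputable def eulerProd (q : ℂ) : ℂ := ∏' n : ℕ, (1 - q ^ (n + 1))

@[simp] theorem eulerProd_zero : eulerProd 0 = 1 := by simp [eulerProd]

theorem eulerProd_ne_zero {q : ℂ} (hq : ‖q‖ < 1) : eulerProd q ≠ 0 := by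
  have h : eulerProd q = ∏' n : ℕ, (1 + -q ^ (n + 1)) := by
    simp only [eulerProd, sub_eq_add_neg]
  rw [h]
  refine tprod_one_add_ne_zero_of_summable (fun n h0 => ?_) ?_
  · have h1 : q ^ (n + 1) = 1 := by linear_combination -h0
    have h2 : ‖q‖ ^ (n + 1) < 1 := pow_lt_one₀ (norm_nonneg _) hq n.succ_ne_zero
    rw [← norm_pow, h1, norm_one] at h2
    exact lt_irrefl _ h2
  · simpa using (summable_nat_add_iff 1).mpr (summable_geometric_of_lt_one (norm_nonneg _) hq)

theorem differentiableOn_eulerProd : DifferentiableOn ℂ eulerProd (Metric.ball 0 1) :=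
  ModularForm.differentiableOn_tprod_one_sub_pow

theorem eta_eq (z : ℂ) : ModularForm.eta z = e (z / 24) * eulerProd (e z) := by
  unfold ModularForm.eta eulerProd e ModularForm.eta_q Function.Periodic.qParam
  push_cast
  simp [mul_div_assoc]

theorem norm_e_lt_one {z : ℂ} (hz : 0 < z.im) : ‖e z‖ < 1 := by
  rw [norm_e, Real.exp_lt_one_iff]
  have := Real.pi_pos
  have : 0 < 2 * Real.pi * z.im := by positivity
  linarith

theorem exists_hasSum_of_differentiableOn {P : ℂ → ℂ} (hP : DifferentiableOn ℂ P (Metric.ball 0 1)) :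
    ∃ b : ℕ → ℂ, b 0 = P 0 ∧ ∀ q : ℂ, ‖q‖ < 1 → HasSum (fun n => b n * q ^ n) (P q) := by
  refine ⟨fun n => (n.factorial : ℂ)⁻¹ * iteratedDeriv n P 0, by simp, fun q hq => ?_⟩
  have h := Complex.hasSum_taylorSeries_on_ball (r := 1) (c := 0) (f := P) (by simpa using hP)
    (z := q) (by simpa using hq)
  simpa [mul_assoc, mul_comm, mul_left_comm] using h

theorem differentiableOn_eulerProd_quotient (A B : ℕ) {m n : ℕ} (hm : m ≠ 0) (hn : n ≠ 0) :
    DifferentiableOn ℂ (fun q => eulerProd (q ^ m) ^ A / eulerProd (q ^ n) ^ B)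
      (Metric.ball 0 1) := by
  have hmaps : ∀ {j : ℕ}, j ≠ 0 → Set.MapsTo (fun q : ℂ => q ^ j) (Metric.ball 0 1)
      (Metric.ball 0 1) := fun {j} hj q hq => by
    rw [mem_ball_zero_iff] at hq ⊢
    rw [norm_pow]
    exact pow_lt_one₀ (norm_nonneg _) hq hj
  refine ((differentiableOn_eulerProd.comp (by fun_prop) (hmaps hm)).pow A).div
    ((differentiableOn_eulerProd.comp (by fun_prop) (hmaps hn)).pow B) fun q hq => ?_
  exact pow_ne_zero _ (eulerProd_ne_zero (mem_ball_zero_iff.mp (hmaps hn hq)))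

theorem mdifferentiable_eta_quotient (A B : ℕ) {N : ℕ} (hN : 0 < N) :
    MDifferentiable 𝓘(ℂ) 𝓘(ℂ)
      (fun τ : ℍ => ModularForm.eta τ ^ A / ModularForm.eta (N * τ) ^ B) := by
  rw [UpperHalfPlane.mdifferentiable_iff]
  have hmaps : ∀ z : ℂ, 0 < z.im → 0 < ((N : ℂ) * z).im := fun z hz => by
    simpa [hN] using hz
  have hd : DifferentiableOn ℂ (fun z : ℂ => ModularForm.eta z ^ A / ModularForm.eta (N * z) ^ B)
      {z | 0 < z.im} := fun z hz => by
    refine DifferentiableAt.differentiableWithinAt ?_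
    refine ((ModularForm.differentiableAt_eta_of_mem_upperHalfPlaneSet hz).pow A).div
      (((ModularForm.differentiableAt_eta_of_mem_upperHalfPlaneSet (hmaps z hz)).comp z
        (by fun_prop : DifferentiableAt ℂ (fun z : ℂ => (N : ℂ) * z) z)).pow B) ?_
    exact pow_ne_zero _ (ModularForm.eta_ne_zero (hmaps z hz))
  refine hd.congr fun z hz => ?_
  simp [UpperHalfPlane.ofComplex_apply_of_im_pos hz]

/-- The expansion of `η(τ)^A / η(Nτ)^B` at `∞` if the order there is `-1/N`. -/
theorem exists_hasSum_eta_quotient {A B N : ℕ} (hN : 0 < N) (hAB : (A - B * N : ℚ) / 24 = -1 / N) :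
    ∃ b : ℕ → ℂ, b 0 = 1 ∧ ∀ τ : ℍ, HasSum (fun n : ℕ => b n * e (((n - 1 / N : ℚ) : ℂ) * τ))
      (ModularForm.eta τ ^ A / ModularForm.eta (N * τ) ^ B) := by
  obtain ⟨b, hb0, hb⟩ := exists_hasSum_of_differentiableOn
    (differentiableOn_eulerProd_quotient A B one_ne_zero hN.ne')
  refine ⟨b, by simp [hb0, zero_pow hN.ne'], fun τ => ?_⟩
  have h := (hb (e τ) (norm_e_lt_one τ.2)).mul_left (e (-1 / N * τ))
  have h1 : (fun n : ℕ => b n * e (((n - 1 / N : ℚ) : ℂ) * τ)) =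
      fun n => e (-1 / N * τ) * (b n * e τ ^ n) := by
    funext n
    rw [← e_nat_mul, mul_left_comm, ← e_add]
    push_cast
    ring_nf
  have h2 : ModularForm.eta τ ^ A / ModularForm.eta (N * τ) ^ B = e (-1 / N * τ) *
      (eulerProd (e τ ^ 1) ^ A / eulerProd (e τ ^ N) ^ B) := by
    have hAB' : ((A - B * N : ℚ) / 24 : ℂ) = -1 / N := by exact_mod_cast congrArg (Rat.cast : ℚ → ℂ) hAB
    rw [eta_eq, eta_eq, mul_pow, mul_pow, pow_one, ← e_nat_mul N, mul_div_mul_comm, ← e_nat_mul,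
      ← e_nat_mul]
    congr 1
    rw [div_eq_iff (e_ne_zero _), ← e_add, ← hAB']
    congr 1
    push_cast
    ring
  rw [h1, h2]
  exact h

/-- The expansion of `η(τ)^A / η(τ/N)^B` at `∞` if the order there is `0`. -/
theorem exists_hasExpansion_eta_quotient {A B N : ℕ} (hN : 0 < N) (hAB : A * N = B) (u : ℂ) :
    ∃ a : ℕ → ℂ, a 0 = u ∧ HasExpansion N a
      (fun τ => u * (ModularForm.eta τ ^ A / ModularForm.eta ((τ : ℂ) / N) ^ B)) := by
  have hN0 : (N : ℂ) ≠ 0 := Nat.cast_ne_zero.mpr hN.ne'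
  obtain ⟨b, hb0, hb⟩ := exists_hasSum_of_differentiableOn
    (differentiableOn_eulerProd_quotient A B hN.ne' one_ne_zero)
  refine ⟨fun n => u * b n, by simp [hb0, zero_pow hN.ne'], fun τ => ?_⟩
  have him : 0 < ((τ : ℂ) / N).im := by
    have := τ.2
    have hN' : (0 : ℝ) < N := by exact_mod_cast hN
    rw [Complex.div_natCast_im]
    positivity
  have h := (hb (e (τ / N)) (norm_e_lt_one him)).mul_left u
  have h1 : (fun n : ℕ => u * b n * e ((n : ℂ) * τ / N)) =
      fun n => u * (b n * e (τ / N) ^ n) := by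
    funext n
    rw [← e_nat_mul, mul_assoc, mul_div_assoc]
  have h2 : ModularForm.eta τ ^ A / ModularForm.eta ((τ : ℂ) / N) ^ B =
      eulerProd (e (τ / N) ^ N) ^ A / eulerProd (e (τ / N) ^ 1) ^ B := by
    rw [eta_eq, eta_eq, mul_pow, mul_pow, pow_one, ← e_nat_mul N, mul_div_cancel₀ _ hN0,
      mul_div_mul_comm, ← e_nat_mul, ← e_nat_mul, ← hAB]
    have h3 : ((A * N : ℕ) : ℂ) * (τ / N / 24) = A * (τ / 24) := by
      push_cast
      field_simp
    rw [h3, div_self (e_ne_zero _), one_mul]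
  rw [h1]
  simp only [h2]
  exact h

/-- A positive factor does not change the argument, so the principal branch is multiplicative here.
-/
theorem csqrt_ofReal_mul {r : ℝ} (hr : 0 < r) {z : ℂ} (hz : z ≠ 0) :
    Complex.sqrt (r * z) = (Real.sqrt r : ℂ) * Complex.sqrt z := by
  have hr' : (r : ℂ) ≠ 0 := by exact_mod_cast hr.ne'
  rw [sqrt_eq_exp (mul_ne_zero hr' hz), sqrt_eq_exp hz, Complex.log_ofReal_mul hr hz,
    add_div, Complex.exp_add, Real.sqrt_eq_rpow, Real.rpow_def_of_pos hr]
  push_cast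
  ring_nf

/-- The transformation of `η` under `τ ↦ -1/τ`, with the square root `√(τ/i)` made explicit. -/
theorem exists_sqrt_eta_neg_inv (τ : ℍ) {N : ℕ} (hN : 0 < N) :
    ∃ w : ℂ, w ^ 2 = -Complex.I * τ ∧ ModularForm.eta (-1 / (τ : ℂ)) = w * ModularForm.eta τ ∧
      ModularForm.eta (N * (-1 / (τ : ℂ))) =
        w / (Real.sqrt N : ℂ) * ModularForm.eta ((τ : ℂ) / N) := by
  have h := fun z (hz : z ∈ UpperHalfPlane.upperHalfPlaneSet) => ModularForm.eta_comp_eq_csqrt_I_inv hz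
  simp only [Function.comp_apply, Pi.smul_apply, Pi.mul_apply, smul_eq_mul] at h
  have hsq : ∀ z : ℂ, z ≠ 0 → Complex.sqrt z ^ 2 = z := fun z hz => by
    rw [sqrt_eq_exp hz, ← Complex.exp_nat_mul, Nat.cast_ofNat,
      mul_div_cancel₀ _ (two_ne_zero' ℂ), Complex.exp_log hz]
  have hN' : (0 : ℝ) < N := by exact_mod_cast hN
  have hτ : (τ : ℂ) ≠ 0 := UpperHalfPlane.ne_zero τ
  -- One `w` serves both eta values, so only `w² = -iτ` is needed later and no branch of the root
  -- has to be tracked.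
  refine ⟨(Complex.sqrt Complex.I)⁻¹ * Complex.sqrt τ, ?_, ?_, ?_⟩
  · rw [mul_pow, inv_pow, hsq _ Complex.I_ne_zero, hsq _ hτ, Complex.inv_I]
  · rw [h τ τ.2, mul_assoc]
  · have him : 0 < ((τ : ℂ) / N).im := by
      have := τ.2
      rw [Complex.div_natCast_im]
      positivity
    have h1 : (N : ℂ) * (-1 / (τ : ℂ)) = -1 / ((τ : ℂ) / N) := by
      have : (N : ℂ) ≠ 0 := Nat.cast_ne_zero.mpr hN.ne'
      field_simp
    have h2 : Complex.sqrt ((τ : ℂ) / N) = Complex.sqrt τ / (Real.sqrt N : ℂ) := by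
      have h3 := csqrt_ofReal_mul (inv_pos.mpr hN') hτ
      rw [Real.sqrt_inv] at h3
      push_cast at h3
      rw [div_eq_inv_mul, h3, div_eq_inv_mul]
    rw [h1, h _ him, h2]
    ring

theorem slash_S_apply_of_eq (f : ℍ → ℂ) (F : ℂ → ℂ) (hF : ∀ τ : ℍ, f τ = F τ) (k : ℤ) (τ : ℍ) :
    (f ∣[k] S) τ = F (-1 / τ) * (τ : ℂ) ^ (-k) := by
  rw [ModularForm.SL_slash_apply, hF, ModularGroup.denom_S, UpperHalfPlane.modular_S_smul]
  congr 2
  simp [neg_div, inv_neg]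

/-- The constant is `(√3)³ w / w³ · τ = 3√3 τ / (-iτ) = 3√3 i`. -/
theorem etaProduct3_slash_S (τ : ℍ) : (etaProduct3 ∣[(-1 : ℤ)] S) τ =
    3 * (Real.sqrt 3 : ℂ) * Complex.I *
      (ModularForm.eta τ / ModularForm.eta ((τ : ℂ) / 3) ^ 3) := by
  obtain ⟨w, hw, h1, h2⟩ := exists_sqrt_eta_neg_inv τ (N := 3) (by norm_num)
  rw [slash_S_apply_of_eq etaProduct3 (fun z => ModularForm.eta z / ModularForm.eta (3 * z) ^ 3)
    fun _ => rfl]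
  push_cast at h2
  simp only [h1, h2]
  have hτ : (τ : ℂ) ≠ 0 := UpperHalfPlane.ne_zero τ
  have hw0 : w ≠ 0 := by
    rintro rfl
    simp [hτ] at hw
  have h3 : (Real.sqrt 3 : ℂ) ^ 2 = 3 := by
    rw [← Complex.ofReal_pow, Real.sq_sqrt (by norm_num)]
    norm_num
  have him : ModularForm.eta ((τ : ℂ) / 3) ≠ 0 := by
    refine ModularForm.eta_ne_zero ?_
    have := τ.2
    change 0 < ((τ : ℂ) / 3).im
    have h := Complex.div_natCast_im (τ : ℂ) 3
    push_cast at h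
    rw [h]
    positivity
  have h30 : (Real.sqrt 3 : ℂ) ≠ 0 := fun h0 => by
    rw [h0] at h3
    norm_num at h3
  rw [neg_neg, zpow_one]
  field_simp
  rw [hw]
  linear_combination (ModularForm.eta τ * τ) * h3 + (3 * ModularForm.eta τ * τ) * Complex.I_sq

/-- The constant is `(√2)⁸ w⁴ / w⁸ · τ² = 16 τ² / (-τ²) = -16`. -/
theorem etaProduct2_slash_S (τ : ℍ) : (etaProduct2 ∣[(-2 : ℤ)] S) τ =
    -16 * (ModularForm.eta τ ^ 4 / ModularForm.eta ((τ : ℂ) / 2) ^ 8) := by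
  obtain ⟨w, hw, h1, h2⟩ := exists_sqrt_eta_neg_inv τ (N := 2) (by norm_num)
  rw [slash_S_apply_of_eq etaProduct2 (fun z => ModularForm.eta z ^ 4 / ModularForm.eta (2 * z) ^ 8)
    fun _ => rfl]
  push_cast at h2
  simp only [h1, h2]
  have hτ : (τ : ℂ) ≠ 0 := UpperHalfPlane.ne_zero τ
  have hw0 : w ≠ 0 := by
    rintro rfl
    simp [hτ] at hw
  have h3 : (Real.sqrt 2 : ℂ) ^ 8 = 16 := by
    rw [show 8 = 2 * 4 from rfl, pow_mul, ← Complex.ofReal_pow, Real.sq_sqrt (by norm_num)]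
    norm_num
  have hw4 : w ^ 4 = -(τ : ℂ) ^ 2 := by
    rw [show 4 = 2 * 2 from rfl, pow_mul, hw, mul_pow, neg_sq, Complex.I_sq]
    ring
  have him : ModularForm.eta ((τ : ℂ) / 2) ≠ 0 := by
    refine ModularForm.eta_ne_zero ?_
    have := τ.2
    change 0 < ((τ : ℂ) / 2).im
    have h := Complex.div_natCast_im (τ : ℂ) 2
    push_cast at h
    rw [h]
    positivity
  rw [neg_neg, zpow_ofNat, mul_pow, mul_pow, div_pow, h3, show w ^ 8 = w ^ 4 * w ^ 4 by ring, hw4]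
  field_simp

/-- The order at `∞` is `(1 - 9)/24 = -1/3`, and that of `f|S` is `(1 - 3/3)/24 = 0`. -/
theorem isLiftable_etaProduct3 : ∃ b a : ℕ → ℂ, a 0 = 3 * (Real.sqrt 3 : ℂ) * Complex.I ∧
    IsLiftable 3 (-1) etaProduct3 b a := by
  obtain ⟨b, hb0, hb⟩ := exists_hasSum_eta_quotient (A := 1) (B := 3) (N := 3) (by norm_num)
    (by norm_num)
  obtain ⟨a, ha0, ha⟩ := exists_hasExpansion_eta_quotient (A := 1) (B := 3) (N := 3) (by norm_num)
    (by norm_num) (3 * (Real.sqrt 3 : ℂ) * Complex.I)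
  have hd := mdifferentiable_eta_quotient 1 3 (N := 3) (by norm_num)
  simp only [pow_one, Nat.cast_ofNat] at hb ha hd
  refine ⟨b, a, ha0, hd, ?_, hb0, ?_⟩
  · exact fun τ => by rw [etaProduct3]; simpa only [Nat.cast_ofNat] using hb τ
  · rw [show etaProduct3 ∣[(-1 : ℤ)] S = _ from funext etaProduct3_slash_S]
    exact ha

/-- The order at `∞` is `(4 - 16)/24 = -1/2`, and that of `f|S` is `(4 - 8/2)/24 = 0`. -/
theorem isLiftable_etaProduct2 : ∃ b a : ℕ → ℂ, a 0 = -16 ∧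
    IsLiftable 2 (-2) etaProduct2 b a := by
  obtain ⟨b, hb0, hb⟩ := exists_hasSum_eta_quotient (A := 4) (B := 8) (N := 2) (by norm_num)
    (by norm_num)
  obtain ⟨a, ha0, ha⟩ := exists_hasExpansion_eta_quotient (A := 4) (B := 8) (N := 2) (by norm_num)
    (by norm_num) (-16)
  have hd := mdifferentiable_eta_quotient 4 8 (N := 2) (by norm_num)
  simp only [Nat.cast_ofNat] at hb ha hd
  refine ⟨b, a, ha0, hd, ?_, hb0, ?_⟩
  · exact fun τ => by rw [etaProduct2]; simpa only [Nat.cast_ofNat] using hb τ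
  · rw [show etaProduct2 ∣[(-2 : ℤ)] S = _ from funext etaProduct2_slash_S]
    exact ha

/-! ### Small roots of unity and the Legendre symbol modulo 3 -/

theorem coe_int_div_eq_zero_iff {N : ℕ} [NeZero N] (m : ℤ) :
    (((m : ℚ) / N : ℚ) : QmodZ) = 0 ↔ (N : ℤ) ∣ m := by
  have hN : (N : ℚ) ≠ 0 := Nat.cast_ne_zero.mpr (NeZero.ne N)
  rw [coe_QmodZ_eq_zero_iff]
  refine exists_congr fun n => ?_
  rw [eq_div_iff hN]
  constructor
  · intro h
    have h' : n * (N : ℤ) = m := by exact_mod_cast h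
    rw [← h', mul_comm]
  · rintro rfl
    push_cast
    ring

theorem e_half : e (1 / 2) = -1 := by
  rw [e, show 2 * (Real.pi : ℂ) * Complex.I * (1 / 2) = Real.pi * Complex.I by ring,
    Complex.exp_pi_mul_I]

theorem e_third : e (1 / 3) = -1 / 2 + (Real.sqrt 3 : ℂ) / 2 * Complex.I := by
  have h : 2 * (Real.pi : ℂ) * Complex.I * (1 / 3) =
      ((Real.pi - Real.pi / 3 : ℝ) : ℂ) * Complex.I := by
    push_cast; ring
  rw [e, h, Complex.exp_mul_I, ← Complex.ofReal_cos, ← Complex.ofReal_sin, Real.cos_pi_sub,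
    Real.sin_pi_sub, Real.cos_pi_div_three, Real.sin_pi_div_three]
  push_cast
  ring

theorem e_two_thirds : e (2 / 3) = -1 / 2 - (Real.sqrt 3 : ℂ) / 2 * Complex.I := by
  have h3 : (Real.sqrt 3 : ℂ) ^ 2 = 3 := by
    rw [← Complex.ofReal_pow, Real.sq_sqrt (by norm_num)]
    norm_num
  rw [show (2 / 3 : ℂ) = 1 / 3 + 1 / 3 by norm_num, e_add, e_third]
  linear_combination (1 / 4 * Complex.I ^ 2) * h3 + 3 / 4 * Complex.I_sq

theorem e_quarter : e (1 / 4) = Complex.I := by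
  rw [e, show 2 * (Real.pi : ℂ) * Complex.I * (1 / 4) = Real.pi / 2 * Complex.I by ring,
    Complex.exp_pi_div_two_mul_I]

theorem e_neg (z : ℂ) : e (-z) = (e z)⁻¹ := by
  refine eq_inv_of_mul_eq_one_left ?_
  rw [← e_add, neg_add_cancel, e_zero]

/-- The value of `e(m/3)` depends only on `m` modulo `3`. -/
theorem e_div_three (m : ℤ) : e ((m : ℂ) / 3) = if m % 3 = 0 then 1 else
    if m % 3 = 1 then -1 / 2 + (Real.sqrt 3 : ℂ) / 2 * Complex.I
    else -1 / 2 - (Real.sqrt 3 : ℂ) / 2 * Complex.I := by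
  have h : (m : ℂ) / 3 = ((m % 3 : ℤ) : ℂ) / 3 + ((m / 3 : ℤ) : ℂ) := by
    have := Int.emod_add_mul_ediv m 3
    have h' : ((m % 3 : ℤ) : ℂ) + 3 * ((m / 3 : ℤ) : ℂ) = m := by exact_mod_cast this
    rw [← h']; ring
  rw [h, e_add_int]
  have h0 := Int.emod_nonneg m (by norm_num : (3 : ℤ) ≠ 0)
  have h1 := Int.emod_lt_of_pos m (by norm_num : (0 : ℤ) < 3)
  rcases (by omega : m % 3 = 0 ∨ m % 3 = 1 ∨ m % 3 = 2) with h | h | h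
  · simp [h]
  · rw [h, ← e_third]; norm_num
  · rw [h, ← e_two_thirds]; norm_num

theorem legendreSym_three_two_mul (a : ℤ) :
    legendreSym 3 (2 * a) = if a % 3 = 0 then 0 else if a % 3 = 1 then -1 else 1 := by
  rw [legendreSym.mod]
  rcases (by omega : a % 3 = 0 ∨ a % 3 = 1 ∨ a % 3 = 2) with h | h | h
  · rw [show 2 * a % ((3 : ℕ) : ℤ) = 0 by omega]
    simp [h]
  · rw [show 2 * a % ((3 : ℕ) : ℤ) = 2 by omega]
    simp only [h, one_ne_zero, if_false, if_true]
    rw [legendreSym.eq_neg_one_iff]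
    decide
  · rw [show 2 * a % ((3 : ℕ) : ℤ) = 1 by omega]
    simp [h]

namespace EvenLattice

variable {V : Type*} [AddCommGroup V] [Module ℚ V] {L : EvenLattice V}

/-! ### Discriminant forms which are orthogonal sums -/

/-- Everything is checked on the summands: nondegeneracy by pairing with vectors supported in one
coordinate, Milgram's formula because the Gauss sum of an orthogonal sum is the product of the Gauss
sums. -/
theorem isNiceOfLevel_of_orthogonalSum {N n : ℕ} [NeZero N] {A : Type*} [AddCommGroup A] [Fintype A]
    [DecidableEq A] (φ : (Fin n → A) ≃+ L.Disc) (m : Fin n → A → ℤ)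
    (hQ : ∀ x, L.Q (φ x) = (((∑ i, m i (x i) : ℤ) / (N : ℚ) : ℚ) : QmodZ)) (hm0 : ∀ i, m i 0 = 0)
    (hnd : ∀ i u, u ≠ 0 → ∃ v, ¬(N : ℤ) ∣ m i (v + u) - m i v - m i u)
    (hG : ∏ i, ∑ u, e ((m i u : ℂ) / N) =
      (Real.sqrt (Fintype.card A ^ n : ℕ) : ℂ) * e ((L.sigDiff : ℂ) / 8)) :
    L.IsNiceOfLevel N := by
  have hN : (N : ℚ) ≠ 0 := Nat.cast_ne_zero.mpr (NeZero.ne N)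
  refine ⟨Finite.of_equiv _ φ.toEquiv, fun γ => ?_, fun γ hγ => ?_, ?_⟩
  · obtain ⟨x, rfl⟩ := φ.surjective γ
    rw [hQ, ← AddCircle.coe_nsmul, nsmul_eq_mul, mul_div_cancel₀ _ hN]
    exact coe_int_QmodZ _
  · obtain ⟨x, rfl⟩ := φ.surjective γ
    rw [EmbeddingLike.map_eq_zero_iff]
    funext i
    by_contra hi
    obtain ⟨v, hv⟩ := hnd i (x i) hi
    refine hv ?_
    have h := hγ (φ (Pi.single i v))
    rw [pairing, ← map_add, hQ, hQ, hQ, ← AddCircle.coe_sub, ← AddCircle.coe_sub, ← sub_div,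
      ← sub_div, ← Int.cast_sub, ← Int.cast_sub, coe_int_div_eq_zero_iff, ← Finset.sum_sub_distrib,
      ← Finset.sum_sub_distrib, Finset.sum_eq_single i] at h
    · simpa using h
    · intro j _ hj
      simp [Pi.single_eq_of_ne hj, hm0]
    · simp
  · have hcard : Nat.card L.Disc = Fintype.card A ^ n := by
      rw [← Nat.card_congr φ.toEquiv, Nat.card_eq_fintype_card]
      simp
    rw [hcard, ← hG, ← finsum_comp_equiv φ.toEquiv, finsum_eq_sum_of_fintype, Finset.prod_univ_sum,
      Fintype.piFinset_univ]
    refine Finset.sum_congr rfl fun x _ => ?_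
    change eQ (L.Q (φ x)) = _
    rw [hQ, eQ_coe]
    push_cast
    rw [Finset.sum_div]
    induction (Finset.univ : Finset (Fin n)) using Finset.induction_on with
    | empty => simp
    | insert i s hi ih => rw [Finset.sum_insert hi, Finset.prod_insert hi, e_add, ih]

theorem HasSignature.sigDiff_eq {bp bm : ℕ} (h : L.HasSignature bp bm) :
    L.sigDiff = (bp : ℤ) - bm := by
  rw [sigDiff, h.1, h.2]

/-! ### The discriminant form `3^{+5}` -/

section Three

/-- The sum is `1 + 2e(a/3) = ±i√3`, with sign `+` exactly for `a ≡ 1`, where `2a` is a nonresidue.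
-/
theorem sum_e_mul_sq (a : ℤ) (ha : a % 3 ≠ 0) :
    ∑ u : ZMod 3, e (((a * (u.val : ℤ) ^ 2 : ℤ) : ℂ) / (3 : ℕ)) =
      -(legendreSym 3 (2 * a) : ℂ) * (Complex.I * (Real.sqrt 3 : ℂ)) := by
  have h : (Finset.univ : Finset (ZMod 3)) = {0, 1, 2} := by decide
  have h0 : (0 : ZMod 3).val = 0 := rfl
  have h1 : (1 : ZMod 3).val = 1 := rfl
  have h2 : (2 : ZMod 3).val = 2 := rfl
  rw [h, Finset.sum_insert (by decide), Finset.sum_insert (by decide), Finset.sum_singleton,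
    h0, h1, h2, legendreSym_three_two_mul]
  simp only [Nat.cast_ofNat, e_div_three]
  rcases (by omega : a % 3 = 1 ∨ a % 3 = 2) with h | h
  · have h4 : a * 4 % 3 = 1 := by omega
    have h5 : ¬3 ∣ a * 4 := by omega
    norm_num [h, h4, h5]
    ring
  · have h4 : a * 4 % 3 = 2 := by omega
    have h5 : ¬3 ∣ a * 4 := by omega
    norm_num [h, h4, h5]
    ring

variable (hL : L.IsGenus_II_2_4_3_5)
include hL

theorem IsGenus_II_2_4_3_5.sigDiff_eq : L.sigDiff = 2 * (-1) := by
  rw [hL.1.sigDiff_eq]; norm_num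

theorem IsGenus_II_2_4_3_5.exists_equiv :
    ∃ (a : Fin 5 → ℤ) (φ : (Fin 5 → ZMod 3) ≃+ L.Disc),
      (∏ i, legendreSym 3 (2 * a i)) = 1 ∧ (∀ i, a i % 3 ≠ 0) ∧
      ∀ x, L.Q (φ x) = (((∑ i, a i * ((x i).val : ℤ) ^ 2 : ℤ) / ((3 : ℕ) : ℚ) : ℚ) : QmodZ) := by
  obtain ⟨a, φ, ha, hQ⟩ := hL.2
  refine ⟨a, φ, ha, fun i hi => ?_, fun x => ?_⟩
  · rw [Finset.prod_eq_zero (Finset.mem_univ i)] at ha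
    · norm_num at ha
    · rw [legendreSym_three_two_mul, if_pos hi]
  · rw [← hQ fun i => ((x i).val : ℤ)]
    congr 2
    funext i
    simp

theorem IsGenus_II_2_4_3_5.isNiceOfLevel : L.IsNiceOfLevel 3 := by
  obtain ⟨a, φ, ha, ha0, hQ⟩ := hL.exists_equiv
  -- The witness `v = 1` works because the polar form of `a u²` at `(1, u)` is `2au` modulo `3`.
  refine isNiceOfLevel_of_orthogonalSum φ (fun i u => a i * (u.val : ℤ) ^ 2) hQ (by simp)
    (fun i u hu => ⟨1, ?_⟩) ?_
  · have := ha0 i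
    have hu' : u = 1 ∨ u = 2 := by
      revert u; decide
    rcases hu' with rfl | rfl
    · have h1 : (1 : ZMod 3).val = 1 := rfl
      have h2 : (1 + 1 : ZMod 3).val = 2 := rfl
      rw [h1, h2]
      push_cast
      omega
    · have h1 : (1 : ZMod 3).val = 1 := rfl
      have h2 : (2 : ZMod 3).val = 2 := rfl
      have h3 : (1 + 2 : ZMod 3).val = 0 := rfl
      rw [h1, h2, h3]
      push_cast
      omega
  -- The product is `-(i√3)⁵ = -9√3 i = √243 e(-2/8)`.
  · rw [Finset.prod_congr rfl fun i _ => sum_e_mul_sq (a i) (ha0 i), Finset.prod_mul_distrib,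
      Finset.prod_neg, hL.sigDiff_eq]
    have ha' : ∏ i, (legendreSym 3 (2 * a i) : ℂ) = 1 := by exact_mod_cast congrArg (Int.cast : ℤ → ℂ) ha
    have h3 : (Real.sqrt 3 : ℂ) ^ 2 = 3 := by
      rw [← Complex.ofReal_pow, Real.sq_sqrt (by norm_num)]
      norm_num
    have h243 : Real.sqrt 243 = 9 * Real.sqrt 3 := by
      rw [show (243 : ℝ) = 9 ^ 2 * 3 by norm_num, Real.sqrt_mul (by norm_num),
        Real.sqrt_sq (by norm_num)]
    have hcard : ((Fintype.card (ZMod 3) ^ 5 : ℕ) : ℝ) = 243 := by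
      rw [ZMod.card]; norm_num
    have he : e (((2 * (-1) : ℤ) : ℂ) / 8) = -Complex.I := by
      rw [show ((2 * (-1) : ℤ) : ℂ) / 8 = -(1 / 4) by push_cast; ring, e_neg, e_quarter,
        Complex.inv_I]
    rw [ha', hcard, h243, he]
    simp only [Finset.card_univ, Fintype.card_fin, Finset.prod_const]
    push_cast
    have hI : Complex.I ^ 5 = Complex.I := by
      rw [show 5 = 4 + 1 from rfl, pow_succ, Complex.I_pow_four, one_mul]
    rw [mul_pow, hI, show (Real.sqrt 3 : ℂ) ^ 5 = ((Real.sqrt 3 : ℂ) ^ 2) ^ 2 * Real.sqrt 3 by ring,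
      h3]
    ring

theorem IsGenus_II_2_4_3_5.exists_Q_eq : ∃ γ : L.Disc, L.Q γ = ((-1 / 3 : ℚ) : QmodZ) := by
  obtain ⟨a, φ, ha, ha0, hQ⟩ := hL.exists_equiv
  have key : ∀ x : Fin 5 → ZMod 3, (3 : ℤ) ∣ (∑ i, a i * ((x i).val : ℤ) ^ 2) + 1 →
      ∃ γ : L.Disc, L.Q γ = ((-1 / 3 : ℚ) : QmodZ) := fun x hx => by
    refine ⟨φ x, ?_⟩
    rw [hQ, ← sub_eq_zero, ← AddCircle.coe_sub]
    have h := (coe_int_div_eq_zero_iff (N := 3) _).mpr hx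
    rw [← h]
    congr 1
    push_cast
    ring
  have h1 : (1 : ZMod 3).val = 1 := rfl
  -- A coordinate with `a i ≡ 2` gives norm `-1/3` by itself; otherwise all `a i ≡ 1`, and two
  -- coordinates give `1 + 1 ≡ -1`.
  by_cases h : ∃ i, a i % 3 = 2
  · obtain ⟨i, hi⟩ := h
    refine key (Pi.single i 1) ?_
    rw [Finset.sum_eq_single i (fun j _ hj => by simp [Pi.single_eq_of_ne hj]) (by simp),
      Pi.single_eq_same, h1]
    push_cast
    omega
  · push Not at h
    have h01 := h 0
    have h11 := h 1
    have h00 := ha0 0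
    have h10 := ha0 1
    refine key ![1, 1, 0, 0, 0] ?_
    simp only [Fin.sum_univ_five]
    simp [h1]
    omega

end Three

/-! ### The discriminant form `2_{II}^{-6}` -/

section Two

/-- The form `xy` for the sign `1` and `x² + xy + y²` for the sign `-1`. -/
def planeForm (s : ℤ) (u : ZMod 2 × ZMod 2) : ℤ :=
  if s = 1 then (u.1.val : ℤ) * u.2.val else (u.1.val : ℤ) ^ 2 + u.1.val * u.2.val + (u.2.val : ℤ) ^ 2

/-- The hyperbolic plane has three isotropic vectors and one of norm `1/2`; for the anisotropic
plane it is one and three. -/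
theorem sum_e_planeForm {s : ℤ} (hs : s = 1 ∨ s = -1) :
    ∑ u : ZMod 2 × ZMod 2, e ((planeForm s u : ℂ) / (2 : ℕ)) = 2 * s := by
  have h : (Finset.univ : Finset (ZMod 2)) = {0, 1} := by decide
  have h0 : (0 : ZMod 2).val = 0 := rfl
  have h1 : (1 : ZMod 2).val = 1 := rfl
  have h3 : e (3 / 2) = -1 := by
    rw [show (3 / 2 : ℂ) = 1 / 2 + ((1 : ℤ) : ℂ) by push_cast; norm_num, e_add_int, e_half]
  have h2 := e_half
  rw [one_div] at h2
  rw [Fintype.sum_prod_type, h, Finset.sum_insert (by decide), Finset.sum_singleton,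
    Finset.sum_insert (by decide), Finset.sum_singleton, Finset.sum_insert (by decide),
    Finset.sum_singleton]
  rcases hs with rfl | rfl
  · simp [planeForm, h0, h1, h2]
    norm_num
  · simp [planeForm, h0, h1, h2]
    norm_num [h3]

variable (hL : L.IsGenus_II_2_6_2_6)
include hL

theorem IsGenus_II_2_6_2_6.sigDiff_eq : L.sigDiff = 2 * (-2) := by
  rw [hL.1.sigDiff_eq]; norm_num

theorem IsGenus_II_2_6_2_6.exists_equiv :
    ∃ (s : Fin 3 → ℤ) (φ : (Fin 3 → ZMod 2 × ZMod 2) ≃+ L.Disc),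
      (∀ i, s i = 1 ∨ s i = -1) ∧ (∏ i, s i) = -1 ∧
      ∀ x, L.Q (φ x) = (((∑ i, planeForm (s i) (x i) : ℤ) / ((2 : ℕ) : ℚ) : ℚ) : QmodZ) := by
  obtain ⟨s, φ, hs, hs1, hQ⟩ := hL.2
  refine ⟨s, φ, hs, hs1, fun x => ?_⟩
  have h := hQ (fun i => ((x i).1.val : ℤ)) (fun i => ((x i).2.val : ℤ))
  have hx : (fun i => ((((x i).1.val : ℤ) : ZMod 2), (((x i).2.val : ℤ) : ZMod 2))) = x := by
    funext i
    simp
  rw [hx] at h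
  rw [h]
  rfl

theorem IsGenus_II_2_6_2_6.isNiceOfLevel : L.IsNiceOfLevel 2 := by
  obtain ⟨s, φ, hs, hs1, hQ⟩ := hL.exists_equiv
  refine isNiceOfLevel_of_orthogonalSum φ (fun i => planeForm (s i)) hQ (fun i => ?_)
    (fun i => ?_) ?_
  · rcases hs i with h | h <;> rw [h] <;> decide
  · rcases hs i with h | h <;> rw [h] <;> decide
  -- The product is `2³ · (-1) = √64 e(-4/8)`.
  · rw [Finset.prod_congr rfl fun i _ => sum_e_planeForm (hs i), Finset.prod_mul_distrib,
      hL.sigDiff_eq]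
    have hs' : ∏ i, (s i : ℂ) = -1 := by exact_mod_cast congrArg (Int.cast : ℤ → ℂ) hs1
    have hcard : ((Fintype.card (ZMod 2 × ZMod 2) ^ 3 : ℕ) : ℝ) = 8 ^ 2 := by
      rw [Fintype.card_prod, ZMod.card]; norm_num
    have he : e (((2 * (-2) : ℤ) : ℂ) / 8) = -1 := by
      rw [show ((2 * (-2) : ℤ) : ℂ) / 8 = -(1 / 2) by push_cast; ring, e_neg, e_half]
      norm_num
    rw [hs', hcard, Real.sqrt_sq (by norm_num), he]
    simp only [Finset.card_univ, Fintype.card_fin, Finset.prod_const]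
    norm_num

theorem IsGenus_II_2_6_2_6.exists_Q_eq : ∃ γ : L.Disc, L.Q γ = ((1 / 2 : ℚ) : QmodZ) := by
  obtain ⟨s, φ, hs, hs1, hQ⟩ := hL.exists_equiv
  -- Both plane forms are odd at `(1, 1)`, with values `1` and `3`.
  refine ⟨φ (Pi.single 0 (1, 1)), ?_⟩
  have h0 : ∀ i, planeForm (s i) 0 = 0 := fun i => by
    rcases hs i with h | h <;> rw [h] <;> decide
  rw [hQ, Finset.sum_eq_single 0 (fun j _ hj => by rw [Pi.single_eq_of_ne hj, h0]) (by simp),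
    Pi.single_eq_same, ← sub_eq_zero, ← AddCircle.coe_sub]
  have h2 : (2 : ℤ) ∣ planeForm (s 0) (1, 1) - 1 := by
    rcases hs 0 with h | h <;> rw [h] <;> decide
  rw [← (coe_int_div_eq_zero_iff (N := 2) _).mpr h2]
  congr 1
  push_cast
  ring

end Two

end EvenLattice

/-! ### The constant `e(-r/8)/√|D|` in the two cases -/

namespace EvenLattice

variable {V : Type*} [AddCommGroup V] [Module ℚ V] {L : EvenLattice V}

theorem IsGenus_II_2_4_3_5.card_eq (hL : L.IsGenus_II_2_4_3_5) : Nat.card L.Disc = 243 := by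
  obtain ⟨-, φ, -⟩ := hL.exists_equiv
  rw [← Nat.card_congr φ.toEquiv, Nat.card_eq_fintype_card]
  simp

theorem IsGenus_II_2_6_2_6.card_eq (hL : L.IsGenus_II_2_6_2_6) : Nat.card L.Disc = 64 := by
  obtain ⟨-, φ, -⟩ := hL.exists_equiv
  rw [← Nat.card_congr φ.toEquiv, Nat.card_eq_fintype_card]
  simp

theorem IsGenus_II_2_4_3_5.weilConst_eq (hL : L.IsGenus_II_2_4_3_5) :
    L.weilConst = Complex.I / (Real.sqrt 243 : ℂ) := by
  rw [weilConst, hL.card_eq, hL.sigDiff_eq, ← e_quarter]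
  push_cast
  norm_num

theorem IsGenus_II_2_6_2_6.weilConst_eq (hL : L.IsGenus_II_2_6_2_6) :
    L.weilConst = -1 / 8 := by
  rw [weilConst, hL.card_eq, hL.sigDiff_eq, ← e_half]
  have h : Real.sqrt ((64 : ℕ) : ℝ) = 8 := by
    rw [show ((64 : ℕ) : ℝ) = 8 ^ 2 by norm_num, Real.sqrt_sq (by norm_num)]
  rw [h]
  push_cast
  norm_num

end EvenLattice

end BorcherdsLift

/-! ### The two lifts of singular weight -/

open BorcherdsLift in
theorem mainTheorem3 :
    -- the lattice of genus `II_{2,4}(3^{+5})`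
    (∀ (V : Type*) [AddCommGroup V] [Module ℚ V] (L : EvenLattice V), L.IsGenus_II_2_4_3_5 →
      (∃! ρ : Representation ℂ SL(2, ℤ) (L.Disc → ℂ), L.IsWeilRepresentation ρ) ∧
      (∃ γ : L.Disc, L.Q γ = ((-1 / 3 : ℚ) : QmodZ)) ∧
      ∀ ρ : Representation ℂ SL(2, ℤ) (L.Disc → ℂ), L.IsWeilRepresentation ρ →
      ∀ γ : L.Disc, L.Q γ = ((-1 / 3 : ℚ) : QmodZ) →
        L.LiftIsWellDefined ρ 3 (-1) etaProduct3 γ ∧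
        L.IsWeaklyHolomorphicForm ρ (-1) (L.lift ρ 3 (-1) etaProduct3 γ) ∧
        -- `e(-τ/3) e_γ + e(-τ/3) e_{-γ}` is the principal part, and it determines the form
        (∀ G : ℍ → L.Disc → ℂ,
          (L.IsWeaklyHolomorphicForm ρ (-1) G ∧
            L.HasPrincipalPart G (fun δ m =>
              if m = -1 / 3 then L.basisVec γ δ + L.basisVec (-γ) δ else 0)) ↔
          G = L.lift ρ 3 (-1) etaProduct3 γ) ∧
        L.HasConstantCoeff (L.lift ρ 3 (-1) etaProduct3 γ) 2 ∧
        L.HasAutomorphicProductWeight (L.lift ρ 3 (-1) etaProduct3 γ) (singularWeight 4) ∧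
        singularWeight 4 = 1 ∧
        -- the expansion of `f` at the cusp `0` and the explicit formula for the lift
        (∀ τ : ℍ, (etaProduct3 ∣[(-1 : ℤ)] ModularGroup.S) τ =
          3 * (Real.sqrt 3 : ℂ) * Complex.I *
            (ModularForm.eta τ / ModularForm.eta ((τ : ℂ) / 3) ^ 3)) ∧
        ∃ a : ℕ → ℂ, HasExpansion 3 a (etaProduct3 ∣[(-1 : ℤ)] ModularGroup.S) ∧
          ∀ (τ : ℍ) (β : L.Disc),
            L.lift ρ 3 (-1) etaProduct3 γ τ β =
              etaProduct3 τ * L.basisVec γ β + etaProduct3 τ * L.basisVec (-γ) β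
              - 3 * Complex.I / (Real.sqrt 243 : ℂ)
                * (eQ (L.pairing β γ) + eQ (-L.pairing β γ)) * expansionPart 3 a (L.Q β) τ) ∧
    -- the lattice of genus `II_{2,6}(2_{II}^{-6})`
    (∀ (V : Type*) [AddCommGroup V] [Module ℚ V] (L : EvenLattice V), L.IsGenus_II_2_6_2_6 →
      (∃! ρ : Representation ℂ SL(2, ℤ) (L.Disc → ℂ), L.IsWeilRepresentation ρ) ∧
      (∃ γ : L.Disc, L.Q γ = ((1 / 2 : ℚ) : QmodZ)) ∧
      ∀ ρ : Representation ℂ SL(2, ℤ) (L.Disc → ℂ), L.IsWeilRepresentation ρ →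
      ∀ γ : L.Disc, L.Q γ = ((1 / 2 : ℚ) : QmodZ) →
        L.LiftIsWellDefined ρ 2 (-2) etaProduct2 γ ∧
        L.IsWeaklyHolomorphicForm ρ (-2) (L.lift ρ 2 (-2) etaProduct2 γ) ∧
        -- `e(-τ/2) e_γ` is the principal part, and it determines the form
        (∀ G : ℍ → L.Disc → ℂ,
          (L.IsWeaklyHolomorphicForm ρ (-2) G ∧
            L.HasPrincipalPart G (fun δ m => if m = -1 / 2 then L.basisVec γ δ else 0)) ↔
          G = L.lift ρ 2 (-2) etaProduct2 γ) ∧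
        L.HasConstantCoeff (L.lift ρ 2 (-2) etaProduct2 γ) 4 ∧
        L.HasAutomorphicProductWeight (L.lift ρ 2 (-2) etaProduct2 γ) (singularWeight 6) ∧
        singularWeight 6 = 2 ∧
        -- the expansion of `f` at the cusp `0` and the explicit formula for the lift
        (∀ τ : ℍ, (etaProduct2 ∣[(-2 : ℤ)] ModularGroup.S) τ =
          -16 * (ModularForm.eta τ ^ 4 / ModularForm.eta ((τ : ℂ) / 2) ^ 8)) ∧
        ∃ a : ℕ → ℂ, HasExpansion 2 a (etaProduct2 ∣[(-2 : ℤ)] ModularGroup.S) ∧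
          ∀ (τ : ℍ) (β : L.Disc),
            L.lift ρ 2 (-2) etaProduct2 γ τ β =
              etaProduct2 τ * L.basisVec γ β
              - 1 / 4 * eQ (L.pairing β γ) * expansionPart 2 a (L.Q β) τ) := by
  refine ⟨?_, ?_⟩
  · intro V _ _ L hL
    have hnice := hL.isNiceOfLevel
    have hk := hL.sigDiff_eq
    have hN : 3 = 2 ∨ 3 = 3 := Or.inr rfl
    have hev : 3 = 2 → Even (-1 : ℤ) := fun h => absurd h (by norm_num)
    obtain ⟨b, a, ha0, hf⟩ := isLiftable_etaProduct3
    refine ⟨EvenLattice.IsNiceOfLevel.existsUnique_of_eq_two_or_three hN hnice hk hev,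
      hL.exists_Q_eq, fun ρ hρ γ hγ => ?_⟩
    have hγ' : L.Q γ = ((-1 / (3 : ℕ) : ℚ) : QmodZ) := by rw [hγ]; norm_num
    obtain ⟨c, hc, hc0⟩ := EvenLattice.constantCoeff_lift hN hnice hk hev hρ hγ' hf
    -- The value is `-(i/√243) · 3 · 2 · 3√3 i = 18√3/(9√3)`.
    have hc2 : c 0 0 = 2 := by
      have h3 : (Real.sqrt 3 : ℂ) ^ 2 = 3 := by
        rw [← Complex.ofReal_pow, Real.sq_sqrt (by norm_num)]
        norm_num
      have h243 : Real.sqrt 243 = 9 * Real.sqrt 3 := by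
        rw [show (243 : ℝ) = 9 ^ 2 * 3 by norm_num, Real.sqrt_mul (by norm_num),
          Real.sqrt_sq (by norm_num)]
      have h30 : (Real.sqrt 3 : ℂ) ≠ 0 := fun h0 => by
        rw [h0] at h3
        norm_num at h3
      rw [hc0, ha0, hL.weilConst_eq, h243]
      push_cast
      field_simp
      norm_num
    have hw : singularWeight 4 = 1 := by norm_num [singularWeight]
    refine ⟨EvenLattice.liftIsWellDefined hN hnice hk hev hρ hγ' hf,
      EvenLattice.isWeaklyHolomorphicForm_lift hN hnice hk hev hρ hγ' hf, fun G => ?_,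
      ⟨c, hc, hc2⟩, ⟨c, hc, by rw [hc2, hw]; norm_num⟩, hw, etaProduct3_slash_S,
      a, hf.hasExpansion, fun τ β => ?_⟩
    · have h := EvenLattice.isWeaklyHolomorphicForm_and_hasPrincipalPart_iff hN hnice hk hev hρ hγ' hf
        (by norm_num) G
      simpa [Fin.sum_univ_two] using h
    · rw [EvenLattice.lift_apply hN hnice hk hev hρ hγ' hf, hL.weilConst_eq]
      simp [Fin.sum_univ_two, eQ_neg]
      ring
  · intro V _ _ L hL
    have hnice := hL.isNiceOfLevel
    have hk := hL.sigDiff_eq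
    have hN : 2 = 2 ∨ 2 = 3 := Or.inl rfl
    have hev : 2 = 2 → Even (-2 : ℤ) := fun _ => by decide
    obtain ⟨b, a, ha0, hf⟩ := isLiftable_etaProduct2
    refine ⟨EvenLattice.IsNiceOfLevel.existsUnique_of_eq_two_or_three hN hnice hk hev,
      hL.exists_Q_eq, fun ρ hρ γ hγ => ?_⟩
    -- The classes of `1/2` and `-1/2` agree modulo `1`.
    have hγ' : L.Q γ = ((-1 / (2 : ℕ) : ℚ) : QmodZ) := by
      rw [hγ, ← sub_eq_zero, ← AddCircle.coe_sub, coe_QmodZ_eq_zero_iff]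
      exact ⟨1, by norm_num⟩
    obtain ⟨c, hc, hc0⟩ := EvenLattice.constantCoeff_lift hN hnice hk hev hρ hγ' hf
    -- The value is `(-1/8) · 2 · 1 · (-16)`.
    have hc4 : c 0 0 = 4 := by
      rw [hc0, ha0, hL.weilConst_eq]
      norm_num
    have hw : singularWeight 6 = 2 := by norm_num [singularWeight]
    refine ⟨EvenLattice.liftIsWellDefined hN hnice hk hev hρ hγ' hf,
      EvenLattice.isWeaklyHolomorphicForm_lift hN hnice hk hev hρ hγ' hf, fun G => ?_,
      ⟨c, hc, hc4⟩, ⟨c, hc, by rw [hc4, hw]; norm_num⟩, hw, etaProduct2_slash_S,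
      a, hf.hasExpansion, fun τ β => ?_⟩
    · have h := EvenLattice.isWeaklyHolomorphicForm_and_hasPrincipalPart_iff hN hnice hk hev hρ hγ' hf
        (by norm_num) G
      simpa using h
    · rw [EvenLattice.lift_apply hN hnice hk hev hρ hγ' hf, hL.weilConst_eq]
      simp
      norm_num
      ring
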